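/- Let $\mathfrak f$ be a semisimple complex Lie algebra with Killing form $\kappa$, Cartan subalgebra $\mathfrak h$, simple roots $\alpha_1,\dots,\alpha_l$, nilpotent subalgebras $\mathfrak n_\pm$, and root vectors $E_\alpha$ normalised by $\kappa(E_\alpha,E_{-\alpha})=1$. Let $H_i\in\mathfrak h$ be defined by $\kappa(H_i,X)=\alpha_i(X)$ for $X\in\mathfrak h$, let $d_i=\tfrac12\kappa(H_i,H_i)$, $\alpha_i^\vee=d_i^{-1}H_i$, $A_{ij}=\alpha_j(\alpha_i^\vee)$, and let $P_i\in\mathfrak h$ be Killing-dual to the fundamental weight $\omega_i$ (the basis of $\mathfrak h^*$ dual to $(\alpha_j^\vee)$), so that $\alpha_i(P_j)=d_i\delta_{ij}$. Let $\gamma\neq0$ be real and let $c=1$ (split case) or $c=i$ (non-split case). Put $q=e^{-ic\gamma}$ and $q^x=e^{-ic\gamma x}$. Let $\theta$ be a semi-linear involutive automorphism of $\mathfrak f$ with, for all $i$, * split case: $\theta(E_{\pm\alpha_i})=E_{\pm\alpha_i}$; * non-split case: $\theta(E_{\pm\alpha_i})=-\lambda_iE_{\mp\alpha_i}$ with $\lambda_i\in\{1,-1\}$.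 Let $\mathfrak g=\{X\in\mathfrak f:\theta(X)=X\}$, $R=c(\pi_{\mathfrak n_+}-\pi_{\mathfrak n_-})$ and $R^\pm=R\pm c\,\mathrm{Id}$. Realise the connected complex group $G^{\mathbb C}$ as a linear group through a faithful finite-dimensional representation of $\mathfrak f$, and let $G^*\subset G^{\mathbb C}\times G^{\mathbb C}$ be the subgroup generated by the pairs $(\exp R^+X,\exp R^-X)$, $X\in\mathfrak g$. Let $(\Gamma^+,\Gamma^-):M\to G^*$ be a map on a phase space $M$ (the non-abelian moment map), and let the complex functions $Q^H_i$ ($1\le i\le l$) and $Q^E_\alpha$ ($\alpha$ a root) on $M$ be charges of it. This means that $\Gamma^+=M^+D$ and $\Gamma^-=D^{-1}M^-$ with $$D=\exp Z,\qquad Z=ic\gamma\sum_{i=1}^l Q^H_iP_i,\qquad M^\pm=\prod_{k=1}^n\exp\bigl(\pm ic\gamma A_{\pm\beta_k}Q^E_{\pm\beta_k}E_{\pm\beta_k}\bigr),$$ where $\beta_1,\dots,\beta_n$ is a labelling of the positive roots and the $A_\alpha$ are complex constants with $$A_{\pm\alpha_i}=\left(\frac{4\sinh(ic\gamma d_i)}{ic\gamma}\right)^{1/2}\quad\text{(principal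 square root)}.$$ The branch of the logarithm $Z$ of $D$ is the principal one, $|\operatorname{Im}\alpha_i(Z)|<\pi$ for all $i$. Let $\mathscr U_q(\mathfrak g)$ be the commutative complex Poisson algebra generated by $Q^H_i$, $q^{\pm d_iQ^H_i}$ and $Q^E_{\pm\alpha_i}$ with the relations * $q^{d_iQ^H_i}q^{-d_iQ^H_i}=1$ and $\{q^{d_iQ^H_i},x\}=-ic\gamma d_i\,q^{d_iQ^H_i}\{Q^H_i,x\}$ for all $x$, * $\{Q^H_i,Q^H_j\}=0$ and $i\{Q^H_i,Q^E_{\pm\alpha_j}\}=\pm A_{ij}Q^E_{\pm\alpha_j}$, * $i\{Q^E_{\alpha_i},Q^E_{-\alpha_j}\}=\delta_{ij}\dfrac{q^{d_iQ^H_i}-q^{-d_iQ^H_i}}{q^{d_i}-q^{-d_i}}$, * for $i\ne j$, the $q$-Poisson-Serre relations $\{\dots\{\{Q^E_{\pm\alpha_j},Q^E_{\pm\alpha_i}\}_{q^{\pm1}},Q^E_{\pm\alpha_i}\}_{q^{\pm1}}\dots,Q^E_{\pm\alpha_i}\}_{q^{\pm1}}=0$ with $1-A_{ij}$ brackets. Here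 the bracket whose left entry already contains $r$ factors $Q^E_{\pm\alpha_i}$ is $\{X,Q^E_{\pm\alpha_i}\}_{q^{\pm1}}=\{X,Q^E_{\pm\alpha_i}\}\pm c\gamma\,d_i(A_{ij}+2r)\,X\,Q^E_{\pm\alpha_i}$. **Split case.** Suppose that $|\gamma d_i|<\pi$ for all $i$. Then $|q|=1$ and $$\overline{Q^H_i}=-Q^H_i,\qquad \overline{Q^E_{\pm\alpha_i}}=-Q^E_{\pm\alpha_i}.$$ **Non-split case.** Here $q=e^\gamma$ is real and $$\overline{Q^H_i}=Q^H_i,\qquad \overline{Q^E_{\pm\alpha_i}}=\lambda_i\,q^{\mp d_iQ^H_i}\,Q^E_{\mp\alpha_i}.$$ In each case (in the split case again for $|\gamma d_i|<\pi$) these formulas define a real form of $\mathscr U_q(\mathfrak g)$: there is exactly one antilinear involutive automorphism $\tau$ of the Poisson algebra $\mathscr U_q(\mathfrak g)$ with $\tau(q^{d_iQ^H_i})=q^{d_iQ^H_i}$ and * split case: $\tau(Q^H_i)=-Q^H_i$, $\tau(Q^E_{\pm\alpha_i})=-Q^E_{\pm\alpha_i}$; * non-split case, for every choice of signs $\lambda_i$: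 $\tau(Q^H_i)=Q^H_i$, $\tau(Q^E_{\pm\alpha_i})=\lambda_iq^{\mp d_iQ^H_i}Q^E_{\mp\alpha_i}$. The charges reproduce this real form: if a bracket on the complex functions on $M$ commutes with complex conjugation, and an algebra homomorphism $\varphi$ from $\mathscr U_q(\mathfrak g)$ to the functions on $M$ respects brackets and sends the generators to the functions $Q^H_i$, $q^{\pm d_iQ^H_i}$, $Q^E_{\pm\alpha_i}$, then $\varphi(\tau(a))=\overline{\varphi(a)}$ for all $a\in\mathscr U_q(\mathfrak g)$. -/

import Mathlib

open LieAlgebra LieAlgebra.IsKilling LieModule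
open scoped ComplexConjugate

-- matrices form a Lie algebra under the commutator
attribute [local instance 100] LieRing.ofAssociativeRing

noncomputable section

namespace QReality

/-! ### Semisimple Lie algebras: root vectors, real forms, the standard `R`-matrix -/

section LieData

variable {L : Type*} [LieRing L] [LieAlgebra ℂ L]

/-- A semi-linear involutive automorphism of a complex Lie algebra. -/
structure SemilinearInvolution (L : Type*) [LieRing L] [LieAlgebra ℂ L] where
  toMap : L →ₛₗ[starRingEnd ℂ] L
  map_lie : ∀ x y, toMap ⁅x, y⁆ = ⁅toMap x, toMap y⁆
  involutive : ∀ x, toMap (toMap x) = x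

variable [FiniteDimensional ℂ L] [IsKilling ℂ L]
  {H : LieSubalgebra ℂ L} [H.IsCartanSubalgebra]

/-- A choice of root vectors `E α`, one for each root `α`, normalised with respect to the Killing
form by `κ(E α, E (-α)) = 1`. (Nothing is required of `E` at the zero weight.) -/
structure IsRootVectors (E : Weight ℂ H L → L) : Prop where
  mem : ∀ α : Weight ℂ H L, α.IsNonZero → E α ∈ rootSpace H α
  norm : ∀ α : Weight ℂ H L, α.IsNonZero → killingForm ℂ L (E α) (E (-α)) = 1

variable (b : (rootSystem H).Base)

/-- The simple root `α_i`, as a weight. -/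
def simple (i : b.support) : Weight ℂ H L := (i : H.root).1

/-- `H_i`, the element of the Cartan subalgebra Killing-dual to the simple root `α_i`. -/
def simpleH (i : b.support) : H := (cartanEquivDual H).symm (Weight.toLinear ℂ H L (simple b i))

/-- `d_i = κ(H_i, H_i) / 2`. -/
def dSym (i : b.support) : ℂ := killingForm ℂ L (simpleH b i : L) (simpleH b i : L) / 2

/-- The Cartan matrix `A_ij = α_j(α_i^∨)`. (Mathlib's `cartanMatrix i j` is `α_i(α_j^∨)`.) -/
def cartan (i j : b.support) : ℤ := b.cartanMatrix j i

/-- `P_i = ζ(ω_i)`: the Killing dual of the fundamental weight `ω_i`, where the `ω_i` form the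
basis of the dual of the Cartan subalgebra that is dual to the simple coroots. -/
def fundP (i : b.support) : H :=
  (cartanEquivDual H).symm (b.toCoweightBasis.coord i)

/-- The standard `R`-matrix `R = c (π_{𝔫₊} - π_{𝔫₋})`, with the two projections written in the
basis of root vectors: `π_{𝔫±} X = ∑_{α > 0} κ(E_{∓α}, X) E_{±α}`. -/
def stdR (E : Weight ℂ H L → L) (c : ℂ) : L →ₗ[ℂ] L :=
  open Classical in
  c • ∑ α : H.root, if b.IsPos α then
    ((killingForm ℂ L (E (-α.1))).smulRight (E α.1) -
      (killingForm ℂ L (E α.1)).smulRight (E (-α.1))) else 0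

end LieData

/-! ### The complex group and the dual group -/

section Groups

variable {L : Type*} [LieRing L] [LieAlgebra ℂ L] {N : ℕ}

/-- The exponential of a Lie algebra element in the linear group with Lie algebra `ρ(L)`. -/
def gexp (ρ : L →ₗ⁅ℂ⁆ Matrix (Fin N) (Fin N) ℂ) (X : L) : GL (Fin N) ℂ where
  val := NormedSpace.exp (ρ X)
  inv := NormedSpace.exp (-ρ X)
  val_inv := by
    rw [← Matrix.exp_add_of_commute _ _ (Commute.refl (ρ X)).neg_right]; simp
  inv_val := by
    rw [← Matrix.exp_add_of_commute _ _ (Commute.refl (ρ X)).neg_left]; simp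

variable [FiniteDimensional ℂ L] [IsKilling ℂ L]
  {H : LieSubalgebra ℂ L} [H.IsCartanSubalgebra] (b : (rootSystem H).Base)

/-- The dual group `G^*` realised in the (real or complex) double: the connected group of pairs
`(Γ⁺, Γ⁻)` generated by the exponentials of `(R⁺ X, R⁻ X)`, where `X` runs over the real form
`𝔤 = {X | θ X = X}` and `R^± = R ± c`. -/
def dualGroup (ρ : L →ₗ⁅ℂ⁆ Matrix (Fin N) (Fin N) ℂ) (E : Weight ℂ H L → L)
    (θ : SemilinearInvolution L) (c : ℂ) : Subgroup (GL (Fin N) ℂ × GL (Fin N) ℂ) :=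
  Subgroup.closure {p | ∃ X : L, θ.toMap X = X ∧
    p = (gexp ρ (stdR b E c X + c • X), gexp ρ (stdR b E c X - c • X))}

/-! ### The charges -/

/-- `q ^ x` for `q = e^{-icγ}`. -/
def qPow (c : ℂ) (γ : ℝ) (x : ℂ) : ℂ := Complex.exp (-Complex.I * c * γ * x)

/-- `Z = i c γ ∑ Q^H_i P_i`. -/
def cartanZ (c : ℂ) (γ : ℝ) (QH : b.support → ℂ) : H :=
  (Complex.I * c * γ) • ∑ i, QH i • fundP b i

/-- The normalisation constant `(4 sinh(i c γ d_i) / (i c γ))^{1/2}` (principal square root). -/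
def normConst (c : ℂ) (γ : ℝ) (d : ℂ) : ℂ :=
  (4 * Complex.sinh (Complex.I * c * γ * d) / (Complex.I * c * γ)) ^ (1 / 2 : ℂ)

/-- `M⁺ = ∏_k exp(i c γ A_{β_k} Q^E_{β_k} E_{β_k})`, in the order of the labelling `β`. -/
def unipPlus {n : ℕ} (ρ : L →ₗ⁅ℂ⁆ Matrix (Fin N) (Fin N) ℂ) (E : Weight ℂ H L → L)
    (β : Fin n ≃ {α : H.root // b.IsPos α}) (c : ℂ) (γ : ℝ) (A QE : Weight ℂ H L → ℂ) :
    GL (Fin N) ℂ :=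
  (List.ofFn fun k => gexp ρ
    ((Complex.I * c * γ * A (β k).1.1 * QE (β k).1.1) • E (β k).1.1)).prod

/-- `M⁻ = ∏_k exp(-i c γ A_{-β_k} Q^E_{-β_k} E_{-β_k})`, in the order of the labelling `β`. -/
def unipMinus {n : ℕ} (ρ : L →ₗ⁅ℂ⁆ Matrix (Fin N) (Fin N) ℂ) (E : Weight ℂ H L → L)
    (β : Fin n ≃ {α : H.root // b.IsPos α}) (c : ℂ) (γ : ℝ) (A QE : Weight ℂ H L → ℂ) :
    GL (Fin N) ℂ :=
  (List.ofFn fun k => gexp ρ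
    ((-(Complex.I * c * γ * A (-(β k).1.1) * QE (-(β k).1.1))) • E (-(β k).1.1))).prod

/-- `QH`, `QE` are charges of the `G^*`-valued map `(Γ⁺, Γ⁻)` on the phase space `M`:
`Γ⁺ = M⁺ D` and `Γ⁻ = D⁻¹ M⁻` with `D = exp Z`. The branch of the logarithm `Z` of `D` is the
principal one. The constants `A` are the prescribed ones at simple roots and their opposites. -/
structure IsCharges {M : Type*} {n : ℕ} (ρ : L →ₗ⁅ℂ⁆ Matrix (Fin N) (Fin N) ℂ)
    (E : Weight ℂ H L → L) (β : Fin n ≃ {α : H.root // b.IsPos α})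
    (θ : SemilinearInvolution L) (c : ℂ) (γ : ℝ) (A : Weight ℂ H L → ℂ)
    (Γp Γm : M → GL (Fin N) ℂ) (QH : b.support → M → ℂ) (QE : Weight ℂ H L → M → ℂ) : Prop where
  mem_dualGroup : ∀ x, (Γp x, Γm x) ∈ dualGroup b ρ E θ c
  norm_pos : ∀ i, A (simple b i) = normConst c γ (dSym b i)
  norm_neg : ∀ i, A (-simple b i) = normConst c γ (dSym b i)
  plus : ∀ x, Γp x = unipPlus b ρ E β c γ A (fun α => QE α x) *
    gexp ρ (cartanZ b c γ (fun i => QH i x) : L)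
  minus : ∀ x, Γm x = (gexp ρ (cartanZ b c γ (fun i => QH i x) : L))⁻¹ *
    unipMinus b ρ E β c γ A (fun α => QE α x)
  branch : ∀ x i, |(simple b i (cartanZ b c γ (fun j => QH j x))).im| < Real.pi

end Groups

/-! ### The Poisson algebra `𝒰_q(𝔤)` by generators and relations -/

section Uq

variable {ι : Type*}

/-- Generators: `Q^H_i`, `q^{d_i Q^H_i}`, `q^{-d_i Q^H_i}` and `Q^E_{± α_i}`. -/
inductive Gen (ι : Type*) : Type _
  | QH (i : ι) : Gen ι
  | K (i : ι) : Gen ι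
  | Kinv (i : ι) : Gen ι
  | QE (s : ℤˣ) (i : ι) : Gen ι

/-- Formal expressions in the generators. -/
inductive Pre (ι : Type*) : Type _
  | of (g : Gen ι) : Pre ι
  | scalar (a : ℂ) : Pre ι
  | add (x y : Pre ι) : Pre ι
  | mul (x y : Pre ι) : Pre ι
  | pb (x y : Pre ι) : Pre ι

/-- The parameters: `c`, `γ`, the `d_i` and the Cartan matrix. -/
structure UqParam (ι : Type*) where
  c : ℂ
  γ : ℝ
  d : ι → ℂ
  A : ι → ι → ℤ

/-- The iterated `q`-bracket `{…{{Q^E_{± α_j}, Q^E_{± α_i}}_{q^±}, …}_{q^±}, Q^E_{± α_i}}_{q^±}`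
with `r` entries `Q^E_{± α_i}`. Here `{Q_α, Q_β}_{q^±} = {Q_α, Q_β} ± c γ (α, β) Q_α Q_β` and
`(α_j + r α_i, α_i) = d_i (A_ij + 2 r)`. -/
def serre (D : UqParam ι) (s : ℤˣ) (i j : ι) : ℕ → Pre ι
  | 0 => .of (.QE s j)
  | r + 1 => .add (.pb (serre D s i j r) (.of (.QE s i)))
      (.mul (.scalar (((s : ℤ) : ℂ) * D.c * D.γ * (D.d i * ((D.A i j : ℂ) + 2 * r))))
        (.mul (serre D s i j r) (.of (.QE s i))))

/-- The relations: axioms of a commutative complex algebra, axioms of a Poisson bracket, and the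
defining relations of `𝒰_q(𝔤)`. -/
inductive Rel (D : UqParam ι) : Pre ι → Pre ι → Prop
  -- compatibility with the operations
  | add_left {x x'} (y) : Rel D x x' → Rel D (.add x y) (.add x' y)
  | add_right (x) {y y'} : Rel D y y' → Rel D (.add x y) (.add x y')
  | mul_left {x x'} (y) : Rel D x x' → Rel D (.mul x y) (.mul x' y)
  | mul_right (x) {y y'} : Rel D y y' → Rel D (.mul x y) (.mul x y')
  | pb_left {x x'} (y) : Rel D x x' → Rel D (.pb x y) (.pb x' y)
  | pb_right (x) {y y'} : Rel D y y' → Rel D (.pb x y) (.pb x y')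
  -- commutative complex algebra
  | add_comm (x y) : Rel D (.add x y) (.add y x)
  | add_assoc (x y z) : Rel D (.add (.add x y) z) (.add x (.add y z))
  | zero_add (x) : Rel D (.add (.scalar 0) x) x
  | neg_add (x) : Rel D (.add (.mul (.scalar (-1)) x) x) (.scalar 0)
  | mul_comm (x y) : Rel D (.mul x y) (.mul y x)
  | mul_assoc (x y z) : Rel D (.mul (.mul x y) z) (.mul x (.mul y z))
  | one_mul (x) : Rel D (.mul (.scalar 1) x) x
  | zero_mul (x) : Rel D (.mul (.scalar 0) x) (.scalar 0)
  | mul_add (x y z) : Rel D (.mul x (.add y z)) (.add (.mul x y) (.mul x z))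
  | scalar_add (a a') : Rel D (.scalar (a + a')) (.add (.scalar a) (.scalar a'))
  | scalar_mul (a a') : Rel D (.scalar (a * a')) (.mul (.scalar a) (.scalar a'))
  -- Poisson bracket
  | pb_self (x) : Rel D (.pb x x) (.scalar 0)
  | pb_add (x y z) : Rel D (.pb x (.add y z)) (.add (.pb x y) (.pb x z))
  | add_pb (x y z) : Rel D (.pb (.add x y) z) (.add (.pb x z) (.pb y z))
  | pb_scalar (x a) : Rel D (.pb x (.scalar a)) (.scalar 0)
  | leibniz (x y z) : Rel D (.pb x (.mul y z)) (.add (.mul (.pb x y) z) (.mul y (.pb x z)))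
  | jacobi (x y z) : Rel D (.pb x (.pb y z)) (.add (.pb (.pb x y) z) (.pb y (.pb x z)))
  -- `K_i = q^{d_i Q^H_i}` with `q = e^{-icγ}`
  | K_Kinv (i) : Rel D (.mul (.of (.K i)) (.of (.Kinv i))) (.scalar 1)
  | pb_K (i x) : Rel D (.pb (.of (.K i)) x)
      (.mul (.scalar (-Complex.I * D.c * D.γ * D.d i)) (.mul (.of (.K i)) (.pb (.of (.QH i)) x)))
  -- `{Q^H_i, Q^H_j} = 0`
  | QH_QH (i j) : Rel D (.pb (.of (.QH i)) (.of (.QH j))) (.scalar 0)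
  -- `i {Q^H_i, Q^E_{±α_j}} = ± A_ij Q^E_{±α_j}`
  | QH_QE (s : ℤˣ) (i j) : Rel D
      (.mul (.scalar Complex.I) (.pb (.of (.QH i)) (.of (.QE s j))))
      (.mul (.scalar (((s : ℤ) : ℂ) * (D.A i j : ℂ))) (.of (.QE s j)))
  -- `i {Q^E_{α_i}, Q^E_{-α_j}} = δ_ij (q^{d_i Q^H_i} - q^{-d_i Q^H_i}) / (q^{d_i} - q^{-d_i})`
  | QE_QE_same (i) : Rel D
      (.mul (.scalar Complex.I) (.pb (.of (.QE 1 i)) (.of (.QE (-1) i))))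
      (.mul (.scalar (qPow D.c D.γ (D.d i) - qPow D.c D.γ (-D.d i))⁻¹)
        (.add (.of (.K i)) (.mul (.scalar (-1)) (.of (.Kinv i)))))
  | QE_QE_ne (i j) : i ≠ j → Rel D (.pb (.of (.QE 1 i)) (.of (.QE (-1) j))) (.scalar 0)
  -- `q`-Poisson-Serre relations
  | serre (s : ℤˣ) (i j) : i ≠ j → Rel D (QReality.serre D s i j (1 - D.A i j).toNat) (.scalar 0)

/-- The Poisson algebra `𝒰_q(𝔤)`. -/
def Uq (D : UqParam ι) : Type _ := Quot (Rel D)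

namespace Uq

variable (D : UqParam ι)

/-- The class of a formal expression. -/
def mk (x : Pre ι) : Uq D := Quot.mk _ x

instance : Zero (Uq D) := ⟨mk D (.scalar 0)⟩

instance : One (Uq D) := ⟨mk D (.scalar 1)⟩

instance : Add (Uq D) :=
  ⟨Quot.map₂ .add (fun x _ _ h => .add_right x h) (fun _ _ y h => .add_left y h)⟩

instance : Mul (Uq D) :=
  ⟨Quot.map₂ .mul (fun x _ _ h => .mul_right x h) (fun _ _ y h => .mul_left y h)⟩

instance : Neg (Uq D) := ⟨Quot.map (.mul (.scalar (-1))) (fun _ _ h => .mul_right _ h)⟩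

instance : CommRing (Uq D) where
  add_assoc := by rintro ⟨x⟩ ⟨y⟩ ⟨z⟩; exact Quot.sound (.add_assoc x y z)
  zero_add := by rintro ⟨x⟩; exact Quot.sound (.zero_add x)
  add_zero := by
    rintro ⟨x⟩; exact (Quot.sound (.add_comm x _)).trans (Quot.sound (.zero_add x))
  add_comm := by rintro ⟨x⟩ ⟨y⟩; exact Quot.sound (.add_comm x y)
  neg_add_cancel := by rintro ⟨x⟩; exact Quot.sound (.neg_add x)
  mul_assoc := by rintro ⟨x⟩ ⟨y⟩ ⟨z⟩; exact Quot.sound (.mul_assoc x y z)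
  mul_comm := by rintro ⟨x⟩ ⟨y⟩; exact Quot.sound (.mul_comm x y)
  one_mul := by rintro ⟨x⟩; exact Quot.sound (.one_mul x)
  mul_one := by
    rintro ⟨x⟩; exact (Quot.sound (.mul_comm x _)).trans (Quot.sound (.one_mul x))
  left_distrib := by rintro ⟨x⟩ ⟨y⟩ ⟨z⟩; exact Quot.sound (.mul_add x y z)
  right_distrib := by
    rintro ⟨x⟩ ⟨y⟩ ⟨z⟩
    have h1 : mk D (.add (.mul z x) (.mul z y)) = mk D (.add (.mul x z) (.mul y z)) :=
      (Quot.sound (.add_left _ (.mul_comm z x))).trans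
        (Quot.sound (.add_right _ (.mul_comm z y)))
    exact (Quot.sound (.mul_comm _ z)).trans ((Quot.sound (.mul_add z x y)).trans h1)
  zero_mul := by rintro ⟨x⟩; exact Quot.sound (.zero_mul x)
  mul_zero := by
    rintro ⟨x⟩; exact (Quot.sound (.mul_comm x _)).trans (Quot.sound (.zero_mul x))
  nsmul := nsmulRec
  zsmul := zsmulRec

instance : Algebra ℂ (Uq D) := RingHom.toAlgebra
  { toFun := fun a => mk D (.scalar a)
    map_one' := rfl
    map_zero' := rfl
    map_add' := fun a a' => Quot.sound (.scalar_add a a')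
    map_mul' := fun a a' => Quot.sound (.scalar_mul a a') }

/-- The Poisson bracket of `𝒰_q(𝔤)`. -/
def pb : Uq D → Uq D → Uq D :=
  Quot.map₂ .pb (fun x _ _ h => .pb_right x h) (fun _ _ y h => .pb_left y h)

/-- The generator `Q^H_i`. -/
def QH (i : ι) : Uq D := mk D (.of (.QH i))

/-- The generator `q^{d_i Q^H_i}`. -/
def K (i : ι) : Uq D := mk D (.of (.K i))

/-- The generator `q^{-d_i Q^H_i}`. -/
def Kinv (i : ι) : Uq D := mk D (.of (.Kinv i))

/-- The generator `Q^E_{α_i}` (`s = 1`) or `Q^E_{-α_i}` (`s = -1`). -/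
def QE (s : ℤˣ) (i : ι) : Uq D := mk D (.of (.QE s i))

variable {D}

/-- A real structure of the Poisson algebra: an antilinear involutive automorphism of the algebra
which preserves the Poisson bracket. -/
structure IsRealStructure (τ : Uq D →+* Uq D) : Prop where
  antilinear : ∀ a : ℂ, τ (algebraMap ℂ (Uq D) a) = algebraMap ℂ (Uq D) (conj a)
  involutive : ∀ x, τ (τ x) = x
  map_pb : ∀ x y, τ (pb D x y) = pb D (τ x) (τ y)

/-- The real structure defining the split real form. -/
structure IsSplitForm (τ : Uq D →+* Uq D) : Prop extends IsRealStructure τ where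
  QH : ∀ i, τ (Uq.QH D i) = -Uq.QH D i
  K : ∀ i, τ (Uq.K D i) = Uq.K D i
  QE : ∀ s i, τ (Uq.QE D s i) = -Uq.QE D s i

/-- The real structure defining the non-split real form with signs `lam i`. -/
structure IsNonSplitForm (lam : ι → ℤˣ) (τ : Uq D →+* Uq D) : Prop extends
    IsRealStructure τ where
  QH : ∀ i, τ (Uq.QH D i) = Uq.QH D i
  K : ∀ i, τ (Uq.K D i) = Uq.K D i
  QE_pos : ∀ i, τ (Uq.QE D 1 i) =
    algebraMap ℂ (Uq D) ((lam i : ℤ) : ℂ) * (Uq.Kinv D i * Uq.QE D (-1) i)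
  QE_neg : ∀ i, τ (Uq.QE D (-1) i) =
    algebraMap ℂ (Uq D) ((lam i : ℤ) : ℂ) * (Uq.K D i * Uq.QE D 1 i)

/-- `φ` realises the abstract generators of `𝒰_q(𝔤)` as the given functions on `M`, compatibly with
the Poisson brackets. The operation `br` on complex functions is only required to commute with
complex conjugation, as the Poisson bracket of a real phase space does. -/
structure IsEvaluation {M : Type*} (qh qep qem : ι → M → ℂ)
    (br : (M → ℂ) → (M → ℂ) → M → ℂ) (φ : Uq D →ₐ[ℂ] (M → ℂ)) : Prop where
  br_conj : ∀ f g x, br (fun y => conj (f y)) (fun y => conj (g y)) x = conj (br f g x)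
  map_pb : ∀ x y, φ (pb D x y) = br (φ x) (φ y)
  QH : ∀ i, φ (Uq.QH D i) = qh i
  K : ∀ i x, φ (Uq.K D i) x = qPow D.c D.γ (D.d i * qh i x)
  QE_pos : ∀ i, φ (Uq.QE D 1 i) = qep i
  QE_neg : ∀ i, φ (Uq.QE D (-1) i) = qem i

end Uq

end Uq

/-- The parameters of `𝒰_q(𝔤)` attached to a semisimple Lie algebra with a base of its roots. -/
def uqParam {L : Type*} [LieRing L] [LieAlgebra ℂ L] [FiniteDimensional ℂ L] [IsKilling ℂ L]
    {H : LieSubalgebra ℂ L} [H.IsCartanSubalgebra] (b : (rootSystem H).Base) (c : ℂ) (γ : ℝ) :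
    UqParam b.support where
  c := c
  γ := γ
  d := dSym b
  A := cartan b

end QReality

end

noncomputable section

namespace QReality

namespace Uq

variable {ι : Type*} {D : UqParam ι}

/-! ### The Poisson algebra structure of `𝒰_q(𝔤)` -/

/-! The argument has an algebraic half and a Lie-theoretic half, joined at the end by an induction
on generators.

Algebra: `Uq D` is given by generators and relations, so a choice of images of the generators
extends to an antilinear Poisson endomorphism once the images satisfy the complex-conjugated
relations (`IsConjCompatible`, `conjHom`). Being an involution and being unique are then checked on
generators. Only the Serre relations need work. In the split case the iterated bracket is multiplied
by a sign. In the non-split case it goes to a product of signs and powers `q^{∓dQ^H}` times the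
opposite iterated bracket: the cross terms of the Leibniz rule cancel because `d_i A_ij` is
symmetric (`conjLift_nonSplitGen_serre`).

Charges: `θ` sends `H_i` to `±H_i`, with `+` in the split and `-` in the non-split case, and hence
commutes with `R` (`theta_stdR`). So `θ` sends `R^± X` to itself if `c = 1` and to `R^∓ X` if `c =
i`, for `X` fixed by `θ`. On the group level, `θ` intertwines `Ad Γ^±` with itself, respectively `Ad
Γ⁺` with `Ad Γ⁻` (`isTwisted_of_mem_dualGroup`). Everything is read off from the adjoint action,
expressed by the relation `IsAd`.

Let `h` be the element of the Cartan subalgebra with `α_i(h) = 1` for all `i`. Since `M⁺` is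
unipotent for the grading by `ad h`, the `E_{α_i}` component of `Ad Γ⁺ E_{α_i}` is `e^{α_i(Z)}`, and
that of `Ad Γ⁺ h` is `-icγ A Q^E_{α_i}`; there are mirror formulas for `Γ⁻`. Comparing these numbers
under `θ` (`conj_killingForm_theta`) shows that `e^{α_i(Z)}` is real and gives the conjugates of the
`Q^E`. The principal branch makes `α_i(Z) = icγ d_i Q^H_i` itself real. Dividing by the constants is
possible because `d_i > 0` and because the normalisation constants are real and nonzero. -/

theorem mk_eq {x y : Pre ι} (h : Rel D x y) : mk D x = mk D y := Quot.sound h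

theorem pb_self (x : Uq D) : pb D x x = 0 := by
  obtain ⟨x⟩ := x; exact mk_eq (.pb_self x)

theorem pb_add (x y z : Uq D) : pb D x (y + z) = pb D x y + pb D x z := by
  obtain ⟨x⟩ := x; obtain ⟨y⟩ := y; obtain ⟨z⟩ := z; exact mk_eq (.pb_add x y z)

theorem add_pb (x y z : Uq D) : pb D (x + y) z = pb D x z + pb D y z := by
  obtain ⟨x⟩ := x; obtain ⟨y⟩ := y; obtain ⟨z⟩ := z; exact mk_eq (.add_pb x y z)

theorem pb_algebraMap (x : Uq D) (a : ℂ) : pb D x (algebraMap ℂ (Uq D) a) = 0 := by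
  obtain ⟨x⟩ := x; exact mk_eq (.pb_scalar x a)

theorem pb_mul (x y z : Uq D) : pb D x (y * z) = pb D x y * z + y * pb D x z := by
  obtain ⟨x⟩ := x; obtain ⟨y⟩ := y; obtain ⟨z⟩ := z; exact mk_eq (.leibniz x y z)

theorem pb_jacobi (x y z : Uq D) :
    pb D x (pb D y z) = pb D (pb D x y) z + pb D y (pb D x z) := by
  obtain ⟨x⟩ := x; obtain ⟨y⟩ := y; obtain ⟨z⟩ := z; exact mk_eq (.jacobi x y z)

theorem pb_swap (x y : Uq D) : pb D x y = -pb D y x := by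
  have h := pb_self (x + y)
  rw [pb_add, add_pb, add_pb, pb_self, pb_self] at h
  linear_combination h

theorem mul_pb (x y z : Uq D) : pb D (x * y) z = x * pb D y z + pb D x z * y := by
  rw [pb_swap, pb_mul, pb_swap z x, pb_swap z y]; ring

theorem algebraMap_pb (a : ℂ) (x : Uq D) : pb D (algebraMap ℂ (Uq D) a) x = 0 := by
  rw [pb_swap, pb_algebraMap, neg_zero]

theorem pb_const_mul (a : ℂ) (x y : Uq D) :
    pb D x (algebraMap ℂ (Uq D) a * y) = algebraMap ℂ (Uq D) a * pb D x y := by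
  rw [pb_mul, pb_algebraMap]; ring

theorem const_mul_pb (a : ℂ) (x y : Uq D) :
    pb D (algebraMap ℂ (Uq D) a * x) y = algebraMap ℂ (Uq D) a * pb D x y := by
  rw [mul_pb, algebraMap_pb]; ring

theorem pb_neg (x y : Uq D) : pb D x (-y) = -pb D x y := by
  simpa using pb_const_mul (-1) x y

theorem neg_pb (x y : Uq D) : pb D (-x) y = -pb D x y := by
  simpa using const_mul_pb (-1) x y

theorem K_mul_Kinv (i : ι) : K D i * Kinv D i = 1 := mk_eq (.K_Kinv i)

theorem pb_K (i : ι) (x : Uq D) : pb D (K D i) x =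
    algebraMap ℂ (Uq D) (-Complex.I * D.c * D.γ * D.d i) * (K D i * pb D (QH D i) x) := by
  obtain ⟨x⟩ := x; exact mk_eq (.pb_K i x)

/-- Differentiate `K * Kinv = 1` and multiply by `Kinv`. -/
theorem pb_Kinv (i : ι) (x : Uq D) : pb D (Kinv D i) x =
    algebraMap ℂ (Uq D) (Complex.I * D.c * D.γ * D.d i) * (Kinv D i * pb D (QH D i) x) := by
  have h : pb D (K D i * Kinv D i) x = 0 := by
    rw [K_mul_Kinv, ← map_one (algebraMap ℂ (Uq D)), algebraMap_pb]
  rw [mul_pb, pb_K] at h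
  have e : algebraMap ℂ (Uq D) (-Complex.I * D.c * D.γ * D.d i) =
      -algebraMap ℂ (Uq D) (Complex.I * D.c * D.γ * D.d i) := by
    rw [← map_neg]; congr 1; ring
  rw [e] at h
  linear_combination (Kinv D i) * h + (algebraMap ℂ (Uq D) (Complex.I * D.c * D.γ * D.d i) *
    Kinv D i * pb D (QH D i) x - pb D (Kinv D i) x) * K_mul_Kinv i

theorem pb_QH_QH (i j : ι) : pb D (QH D i) (QH D j) = 0 := mk_eq (.QH_QH i j)

theorem algebraMap_I_sq : algebraMap ℂ (Uq D) Complex.I * algebraMap ℂ (Uq D) Complex.I = -1 := by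
  rw [← map_mul, Complex.I_mul_I, map_neg, map_one]

theorem pb_QH_QE (s : ℤˣ) (i j : ι) : pb D (QH D i) (QE D s j) =
    algebraMap ℂ (Uq D) (-Complex.I * ((s : ℤ) * D.A i j)) * QE D s j := by
  have h : algebraMap ℂ (Uq D) Complex.I * pb D (QH D i) (QE D s j) =
    algebraMap ℂ (Uq D) ((s : ℤ) * D.A i j) * QE D s j := mk_eq (.QH_QE s i j)
  rw [map_mul, map_neg]
  linear_combination -algebraMap ℂ (Uq D) Complex.I * h + pb D (QH D i) (QE D s j) *
    algebraMap_I_sq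

theorem pb_QE_same (i : ι) : algebraMap ℂ (Uq D) Complex.I * pb D (QE D 1 i) (QE D (-1) i) =
    algebraMap ℂ (Uq D) (qPow D.c D.γ (D.d i) - qPow D.c D.γ (-D.d i))⁻¹ *
      (K D i + algebraMap ℂ (Uq D) (-1) * Kinv D i) := mk_eq (.QE_QE_same i)

theorem pb_QE_ne {i j : ι} (h : i ≠ j) : pb D (QE D 1 i) (QE D (-1) j) = 0 := mk_eq (.QE_QE_ne i j h)

theorem pb_QH_K (i j : ι) : pb D (QH D i) (K D j) = 0 := by
  rw [pb_swap, pb_K, pb_QH_QH]; ring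

theorem pb_QH_Kinv (i j : ι) : pb D (QH D i) (Kinv D j) = 0 := by
  rw [pb_swap, pb_Kinv, pb_QH_QH]; ring

theorem pb_Kinv_K (i j : ι) : pb D (Kinv D i) (K D j) = 0 := by
  rw [pb_Kinv, pb_QH_K]; ring

/-- The class of the iterated `q`-bracket. -/
def serreElt (D : UqParam ι) (s : ℤˣ) (i j : ι) (r : ℕ) : Uq D := mk D (serre D s i j r)

theorem serreElt_zero (s : ℤˣ) (i j : ι) : serreElt D s i j 0 = QE D s j := rfl

theorem serreElt_succ (s : ℤˣ) (i j : ι) (r : ℕ) : serreElt D s i j (r + 1) =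
    pb D (serreElt D s i j r) (QE D s i) + algebraMap ℂ (Uq D)
      (((s : ℤ) : ℂ) * D.c * D.γ * (D.d i * ((D.A i j : ℂ) + 2 * r))) *
        (serreElt D s i j r * QE D s i) := rfl

theorem serreElt_eq_zero (s : ℤˣ) {i j : ι} (h : i ≠ j) :
    serreElt D s i j (1 - D.A i j).toNat = 0 := mk_eq (.serre s i j h)

/-- The iterated `q`-bracket is a weight vector. -/
theorem pb_QH_serreElt (s : ℤˣ) (k i j : ι) (r : ℕ) : pb D (QH D k) (serreElt D s i j r) =
    algebraMap ℂ (Uq D) (-Complex.I * ((s : ℤ) * (D.A k j + r * D.A k i))) *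
      serreElt D s i j r := by
  induction r with
  | zero => rw [serreElt_zero, pb_QH_QE]; simp
  | succ r ih =>
    have e : algebraMap ℂ (Uq D) (-Complex.I * ((s : ℤ) * (D.A k j + (r + 1 : ℕ) * D.A k i))) =
        algebraMap ℂ (Uq D) (-Complex.I * ((s : ℤ) * (D.A k j + r * D.A k i))) +
        algebraMap ℂ (Uq D) (-Complex.I * ((s : ℤ) * D.A k i)) := by
      rw [← map_add]; congr 1; push_cast; ring
    rw [serreElt_succ, pb_add, pb_jacobi, ih, pb_QH_QE, const_mul_pb, pb_const_mul, pb_const_mul,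
      pb_mul, ih, pb_QH_QE, e]
    ring

/-- Induction along formal expressions. -/
theorem induction {P : Uq D → Prop} (hs : ∀ a, P (algebraMap ℂ (Uq D) a))
    (hQH : ∀ i, P (QH D i)) (hK : ∀ i, P (K D i)) (hKinv : ∀ i, P (Kinv D i))
    (hQE : ∀ s i, P (QE D s i)) (hadd : ∀ x y, P x → P y → P (x + y))
    (hmul : ∀ x y, P x → P y → P (x * y)) (hpb : ∀ x y, P x → P y → P (pb D x y)) (x : Uq D) :
    P x := by
  obtain ⟨x⟩ := x
  change P (mk D x)
  induction x with
  | of g =>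
    cases g with
    | QH i => exact hQH i
    | K i => exact hK i
    | Kinv i => exact hKinv i
    | QE s i => exact hQE s i
  | scalar a => exact hs a
  | add x y hx hy => exact hadd _ _ hx hy
  | mul x y hx hy => exact hmul _ _ hx hy
  | pb x y hx hy => exact hpb _ _ hx hy

/-- Inverses in a commutative ring are unique, so `Kinv` never has to be treated as an independent
generator. -/
theorem map_Kinv_of_map_K {R : Type*} [CommRing R] (f : Uq D →+* R) {i : ι} {k' : R}
    (h : f (K D i) * k' = 1) : f (Kinv D i) = k' := by
  have h2 : f (K D i) * f (Kinv D i) = 1 := by rw [← map_mul, K_mul_Kinv, map_one]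
  linear_combination k' * h2 - f (Kinv D i) * h

/-- Antilinearity fixes the scalars and every element is built from generators by sums, products and
brackets; this is the uniqueness half of both real forms. -/
theorem IsRealStructure.ext {τ τ' : Uq D →+* Uq D} (h : IsRealStructure τ)
    (h' : IsRealStructure τ') (hQH : ∀ i, τ (QH D i) = τ' (QH D i))
    (hK : ∀ i, τ (K D i) = τ' (K D i)) (hQE : ∀ s i, τ (QE D s i) = τ' (QE D s i)) : τ = τ' := by
  refine RingHom.ext fun x => ?_
  induction x using Uq.induction with
  | hs a => rw [h.antilinear, h'.antilinear]
  | hQH i => exact hQH i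
  | hK i => exact hK i
  | hKinv i =>
    refine map_Kinv_of_map_K τ ?_
    rw [hK, ← map_mul, K_mul_Kinv, map_one]
  | hQE s i => exact hQE s i
  | hadd x y hx hy => rw [map_add, map_add, hx, hy]
  | hmul x y hx hy => rw [map_mul, map_mul, hx, hy]
  | hpb x y hx hy => rw [h.map_pb, h'.map_pb, hx, hy]

/-! ### Antilinear extension of a map defined on the generators -/

/-- The antilinear extension of a map on the generators to formal expressions. -/
def conjLift (g : Gen ι → Uq D) : Pre ι → Uq D
  | .of x => g x
  | .scalar a => algebraMap ℂ (Uq D) (conj a)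
  | .add x y => conjLift g x + conjLift g y
  | .mul x y => conjLift g x * conjLift g y
  | .pb x y => pb D (conjLift g x) (conjLift g y)

/-- The images of the generators satisfy the complex conjugates of the defining relations. -/
structure IsConjCompatible (g : Gen ι → Uq D) : Prop where
  K_Kinv : ∀ i, g (.K i) * g (.Kinv i) = 1
  pb_K : ∀ i x, pb D (g (.K i)) x =
    algebraMap ℂ (Uq D) (conj (-Complex.I * D.c * D.γ * D.d i)) *
      (g (.K i) * pb D (g (.QH i)) x)
  QH_QH : ∀ i j, pb D (g (.QH i)) (g (.QH j)) = 0
  QH_QE : ∀ (s : ℤˣ) i j, algebraMap ℂ (Uq D) (conj Complex.I) *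
    pb D (g (.QH i)) (g (.QE s j)) =
      algebraMap ℂ (Uq D) (conj (((s : ℤ) : ℂ) * (D.A i j : ℂ))) * g (.QE s j)
  QE_QE_same : ∀ i, algebraMap ℂ (Uq D) (conj Complex.I) *
    pb D (g (.QE 1 i)) (g (.QE (-1) i)) =
      algebraMap ℂ (Uq D) (conj (qPow D.c D.γ (D.d i) - qPow D.c D.γ (-D.d i))⁻¹) *
        (g (.K i) + algebraMap ℂ (Uq D) (conj (-1)) * g (.Kinv i))
  QE_QE_ne : ∀ i j, i ≠ j → pb D (g (.QE 1 i)) (g (.QE (-1) j)) = 0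
  serre : ∀ (s : ℤˣ) i j, i ≠ j → conjLift g (serre D s i j (1 - D.A i j).toNat) = 0

/-- The algebra and Poisson axioms hold for any images, since they hold in `Uq D`; the hypothesis is
needed only for the defining relations. -/
theorem IsConjCompatible.conjLift_eq {g : Gen ι → Uq D} (hg : IsConjCompatible g) {x y : Pre ι}
    (h : Rel D x y) : conjLift g x = conjLift g y := by
  induction h with
  | add_left y _ ih => simp only [conjLift, ih]
  | add_right x _ ih => simp only [conjLift, ih]
  | mul_left y _ ih => simp only [conjLift, ih]
  | mul_right x _ ih => simp only [conjLift, ih]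
  | pb_left y _ ih => simp only [conjLift, ih]
  | pb_right x _ ih => simp only [conjLift, ih]
  | add_comm x y => exact _root_.add_comm _ _
  | add_assoc x y z => exact _root_.add_assoc _ _ _
  | zero_add x => simp [conjLift]
  | neg_add x => simp [conjLift]
  | mul_comm x y => exact _root_.mul_comm _ _
  | mul_assoc x y z => exact _root_.mul_assoc _ _ _
  | one_mul x => simp [conjLift]
  | zero_mul x => simp [conjLift]
  | mul_add x y z => exact _root_.mul_add _ _ _
  | scalar_add a a' => simp [conjLift]
  | scalar_mul a a' => simp [conjLift]
  | pb_self x => simp only [conjLift, Uq.pb_self, map_zero]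
  | pb_add x y z => exact Uq.pb_add _ _ _
  | add_pb x y z => exact Uq.add_pb _ _ _
  | pb_scalar x a => simp only [conjLift, Uq.pb_algebraMap, map_zero]
  | leibniz x y z => exact Uq.pb_mul _ _ _
  | jacobi x y z => exact Uq.pb_jacobi _ _ _
  | K_Kinv i => simpa only [conjLift, map_one] using hg.K_Kinv i
  | pb_K i x => exact hg.pb_K i _
  | QH_QH i j => simpa only [conjLift, map_zero] using hg.QH_QH i j
  | QH_QE s i j => exact hg.QH_QE s i j
  | QE_QE_same i => exact hg.QE_QE_same i
  | QE_QE_ne i j h => simpa only [conjLift, map_zero] using hg.QE_QE_ne i j h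
  | serre s i j h => simpa only [conjLift, map_zero] using hg.serre s i j h

/-- The antilinear ring endomorphism determined by compatible images of the generators. -/
def conjHom {g : Gen ι → Uq D} (hg : IsConjCompatible g) : Uq D →+* Uq D where
  toFun := Quot.lift (conjLift g) fun _ _ h => hg.conjLift_eq h
  map_one' := by
    change algebraMap ℂ (Uq D) (conj 1) = 1
    simp
  map_zero' := by
    change algebraMap ℂ (Uq D) (conj 0) = 0
    simp
  map_add' := by rintro ⟨x⟩ ⟨y⟩; rfl
  map_mul' := by rintro ⟨x⟩ ⟨y⟩; rfl

theorem conjHom_algebraMap {g : Gen ι → Uq D} (hg : IsConjCompatible g) (a : ℂ) :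
    conjHom hg (algebraMap ℂ (Uq D) a) = algebraMap ℂ (Uq D) (conj a) := rfl

theorem conjHom_pb {g : Gen ι → Uq D} (hg : IsConjCompatible g) (x y : Uq D) :
    conjHom hg (pb D x y) = pb D (conjHom hg x) (conjHom hg y) := by
  obtain ⟨x⟩ := x; obtain ⟨y⟩ := y; rfl

theorem isRealStructure_conjHom {g : Gen ι → Uq D} (hg : IsConjCompatible g)
    (hQH : ∀ i, conjHom hg (g (.QH i)) = QH D i) (hK : ∀ i, conjHom hg (g (.K i)) = K D i)
    (hQE : ∀ s i, conjHom hg (g (.QE s i)) = QE D s i) : IsRealStructure (conjHom hg) where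
  antilinear := conjHom_algebraMap hg
  map_pb := conjHom_pb hg
  involutive x := by
    induction x using Uq.induction with
    | hs a => simp [conjHom_algebraMap]
    | hQH i => exact hQH i
    | hK i => exact hK i
    | hKinv i =>
      symm
      refine map_Kinv_of_map_K (RingHom.id _) ?_
      have h := congrArg (fun x => conjHom hg (conjHom hg x)) (K_mul_Kinv (D := D) i)
      simp only [map_mul, map_one] at h
      rwa [show conjHom hg (conjHom hg (K D i)) = K D i from hK i] at h
    | hQE s i => exact hQE s i
    | hadd x y hx hy => rw [map_add, map_add, hx, hy]
    | hmul x y hx hy => rw [map_mul, map_mul, hx, hy]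
    | hpb x y hx hy => rw [conjHom_pb, conjHom_pb, hx, hy]

/-! ### The split form -/

/-- Images of the generators under the split real structure. -/
def splitGen (D : UqParam ι) : Gen ι → Uq D
  | .QH i => -QH D i
  | .K i => K D i
  | .Kinv i => Kinv D i
  | .QE s i => -QE D s i

/-- For `c = 1` the coefficients of the `q`-brackets are real, so conjugation leaves them alone and
each of the `r + 1` factors contributes one sign. -/
theorem conjLift_splitGen_serre (hc : D.c = 1) (hd : ∀ i, conj (D.d i) = D.d i) (s : ℤˣ) (i j : ι)
    (r : ℕ) : conjLift (splitGen D) (serre D s i j r) = (-1) ^ (r + 1) * serreElt D s i j r := by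
  induction r with
  | zero => simp [serre, conjLift, splitGen, serreElt_zero]
  | succ r ih =>
    -- Writing the sign as a scalar lets it be pulled out of the bracket by `const_mul_pb`.
    have e : (-1 : Uq D) ^ (r + 1) = algebraMap ℂ (Uq D) ((-1) ^ (r + 1)) := by simp
    rw [serre]
    simp only [conjLift]
    rw [ih, serreElt_succ, splitGen, pb_neg, e, const_mul_pb, pow_succ _ (r + 1), e]
    simp only [map_mul, map_add, hc, hd, map_one, map_pow, map_neg, Complex.conj_ofReal,
      map_natCast, map_intCast,
      Complex.conj_ofNat]
    ring

theorem splitGen_compatible (hc : D.c = 1) (hd : ∀ i, conj (D.d i) = D.d i) :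
    IsConjCompatible (splitGen D) where
  K_Kinv := K_mul_Kinv
  pb_K i x := by
    rw [splitGen, splitGen, neg_pb, pb_K, hc]
    simp only [map_mul, map_neg, hd, Complex.conj_I, Complex.conj_ofReal, map_one]
    ring
  QH_QH i j := by rw [splitGen, splitGen, neg_pb, pb_neg, pb_QH_QH]; simp
  QH_QE s i j := by
    rw [splitGen, splitGen, neg_pb, pb_neg, pb_QH_QE]
    simp only [map_mul, map_neg, Complex.conj_I, map_intCast]
    linear_combination ((s : ℤ) * D.A i j * QE D s j) * algebraMap_I_sq (D := D)
  QE_QE_same i := by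
    have h := pb_QE_same (D := D) i
    -- Here `|q| = 1`, so `q^d - q^{-d}` is purely imaginary; its sign change cancels that of `conj
    -- I`.
    have e : conj (qPow D.c D.γ (D.d i) - qPow D.c D.γ (-D.d i))⁻¹ =
        -(qPow D.c D.γ (D.d i) - qPow D.c D.γ (-D.d i))⁻¹ := by
      rw [map_inv₀, ← inv_neg]
      congr 1
      simp only [qPow, map_sub, ← Complex.exp_conj, map_mul, map_neg, Complex.conj_I, hc, map_one,
        Complex.conj_ofReal, hd]
      ring_nf
    rw [e]
    simp only [splitGen]
    rw [neg_pb, pb_neg]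
    simp only [map_neg, Complex.conj_I, map_one] at h ⊢
    linear_combination -h
  QE_QE_ne i j h := by
    simp only [splitGen]
    rw [neg_pb, pb_neg, pb_QE_ne h]; simp
  serre s i j h := by
    rw [conjLift_splitGen_serre hc hd, serreElt_eq_zero s h, mul_zero]

theorem existsUnique_isSplitForm (hc : D.c = 1) (hd : ∀ i, conj (D.d i) = D.d i) :
    ∃! τ : Uq D →+* Uq D, IsSplitForm τ := by
  have hg := splitGen_compatible hc hd
  refine ⟨conjHom hg, ⟨isRealStructure_conjHom hg (fun i => ?_) (fun i => rfl) (fun s i => ?_),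
    fun i => rfl, fun i => rfl, fun s i => rfl⟩, fun τ hτ => ?_⟩
  · change conjHom hg (-QH D i) = _
    rw [map_neg]
    exact neg_neg (QH D i)
  · change conjHom hg (-QE D s i) = _
    rw [map_neg]
    exact neg_neg (QE D s i)
  · refine hτ.toIsRealStructure.ext (isRealStructure_conjHom hg (fun i => ?_) (fun i => rfl)
      (fun s i => ?_)) (fun i => hτ.QH i) (fun i => hτ.K i) (fun s i => hτ.QE s i)
    · change conjHom hg (-QH D i) = _
      rw [map_neg]
      exact neg_neg (QH D i)
    · change conjHom hg (-QE D s i) = _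
      rw [map_neg]
      exact neg_neg (QE D s i)

/-! ### The non-split form -/

/-- The element `q^{∓ d_i Q^H_i}`. -/
def Kpm (D : UqParam ι) (s : ℤˣ) (i : ι) : Uq D := if s = 1 then Kinv D i else K D i

theorem Kpm_one (i : ι) : Kpm D 1 i = Kinv D i := rfl

theorem Kpm_neg_one (i : ι) : Kpm D (-1) i = K D i := rfl

theorem Kpm_mul_Kpm_neg (s : ℤˣ) (i : ι) : Kpm D s i * Kpm D (-s) i = 1 := by
  rcases Int.units_eq_one_or s with rfl | rfl
  · rw [Kpm_one, Kpm_neg_one, mul_comm, K_mul_Kinv]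
  · rw [neg_neg, Kpm_one, Kpm_neg_one, K_mul_Kinv]

theorem pb_Kpm (hc : D.c = Complex.I) (s : ℤˣ) (i : ι) (x : Uq D) : pb D (Kpm D s i) x =
    algebraMap ℂ (Uq D) (-((s : ℤ) * (D.γ * D.d i))) * (Kpm D s i * pb D (QH D i) x) := by
  rcases Int.units_eq_one_or s with rfl | rfl
  · rw [Kpm_one, pb_Kinv, hc]
    congr 2
    rw [Complex.I_mul_I]; push_cast; ring
  · rw [Kpm_neg_one, pb_K, hc]
    congr 2
    rw [neg_mul, Complex.I_mul_I]; push_cast; ring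

theorem pb_QH_Kpm (s : ℤˣ) (i j : ι) : pb D (QH D i) (Kpm D s j) = 0 := by
  rcases Int.units_eq_one_or s with rfl | rfl
  · exact pb_QH_Kinv i j
  · exact pb_QH_K i j

theorem pb_Kpm_Kpm (hc : D.c = Complex.I) (s t : ℤˣ) (i j : ι) :
    pb D (Kpm D s i) (Kpm D t j) = 0 := by
  rw [pb_Kpm hc, pb_QH_Kpm]; ring

/-- Images of the generators under the non-split real structure. -/
def nonSplitGen (D : UqParam ι) (lam : ι → ℤˣ) : Gen ι → Uq D
  | .QH i => QH D i
  | .K i => K D i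
  | .Kinv i => Kinv D i
  | .QE s i => algebraMap ℂ (Uq D) ((lam i : ℤ) : ℂ) * (Kpm D s i * QE D (-s) i)

theorem algebraMap_lam_sq (u : ℤˣ) :
    algebraMap ℂ (Uq D) ((u : ℤ) : ℂ) * algebraMap ℂ (Uq D) ((u : ℤ) : ℂ) = 1 := by
  rcases Int.units_eq_one_or u with rfl | rfl <;> simp

theorem units_sq (s : ℤˣ) : ((s : ℤ) : ℂ) * ((s : ℤ) : ℂ) = 1 := by
  rcases Int.units_eq_one_or s with rfl | rfl <;> simp

/-- The parameters come from a symmetrized Cartan matrix with real symmetrizers. -/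
structure IsSymmetrized (D : UqParam ι) : Prop where
  conj_d : ∀ i, conj (D.d i) = D.d i
  diag : ∀ i, D.A i i = 2
  symm : ∀ i j, D.d i * D.A i j = D.d j * D.A j i

theorem pb_Kpm_mul_pow_Kpm (hc : D.c = Complex.I) (s t : ℤˣ) (i j : ι) (r : ℕ) :
    pb D (Kpm D s j * Kpm D s i ^ r) (Kpm D t i) = 0 := by
  induction r with
  | zero => simp [pb_Kpm_Kpm hc]
  | succ r ih => rw [pow_succ, ← mul_assoc, mul_pb, ih, pb_Kpm_Kpm hc]; ring

/-- The factor `K_j` contributes `d_j A_ji`, which symmetry turns into `d_i A_ij`, and each `K_i`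
contributes `d_i A_ii = 2 d_i`. The eigenvalue thereby matches the one in the `q`-bracket. -/
theorem pb_Kpm_mul_pow_QE (hc : D.c = Complex.I) (hD : IsSymmetrized D) (s : ℤˣ) (i j : ι)
    (r : ℕ) : pb D (Kpm D s j * Kpm D s i ^ r) (QE D (-s) i) =
      algebraMap ℂ (Uq D) (-(Complex.I * (D.γ * (D.d i * (D.A i j + 2 * r))))) *
        (Kpm D s j * Kpm D s i ^ r * QE D (-s) i) := by
  induction r with
  | zero =>
    rw [pow_zero, mul_one, pb_Kpm hc, pb_QH_QE, mul_left_comm (Kpm D s j), ← mul_assoc, ← map_mul]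
    congr 2
    push_cast
    linear_combination -(Complex.I * D.γ * D.d j * D.A j i) * units_sq s +
      Complex.I * D.γ * hD.symm i j
  | succ r ih =>
    have e : algebraMap ℂ (Uq D) (-(Complex.I * (D.γ * (D.d i * (D.A i j + 2 * (r + 1 : ℕ)))))) =
        algebraMap ℂ (Uq D) (-(Complex.I * (D.γ * (D.d i * (D.A i j + 2 * r))))) +
        algebraMap ℂ (Uq D) (-((s : ℤ) * (D.γ * D.d i))) * algebraMap ℂ (Uq D)
          (-Complex.I * (((-s : ℤˣ) : ℤ) * D.A i i)) := by
      rw [← map_mul, ← map_add, hD.diag]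
      congr 1
      push_cast
      linear_combination (2 * Complex.I * D.γ * D.d i) * units_sq s
    rw [pow_succ, ← mul_assoc, mul_pb, ih, pb_Kpm hc, pb_QH_QE, e]
    ring

/-- For `c = i` the coefficients are imaginary, so conjugating them amounts to replacing `s` by
`-s`: the opposite iterated bracket appears. With `U` the accumulated product of `K`-factors and `S`
the opposite bracket, `{U S, K Q}` reduces to `U K {S, Q}`, because `{U, K} = 0` while `{U, Q} S K`
and `U Q {S, K}` cancel. -/
theorem conjLift_nonSplitGen_serre (hc : D.c = Complex.I) (hD : IsSymmetrized D) (lam : ι → ℤˣ)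
    (s : ℤˣ) (i j : ι) (r : ℕ) : conjLift (nonSplitGen D lam) (serre D s i j r) =
      algebraMap ℂ (Uq D) ((lam j : ℤ) * (lam i : ℤ) ^ r) *
        (Kpm D s j * Kpm D s i ^ r * serreElt D (-s) i j r) := by
  induction r with
  | zero => simp [serre, conjLift, nonSplitGen, serreElt_zero]
  | succ r ih =>
    rw [serre]
    simp only [conjLift]
    rw [ih, serreElt_succ, nonSplitGen]
    have h1 := pb_Kpm_mul_pow_Kpm hc s s i j r
    have h2 := pb_Kpm_mul_pow_QE hc hD s i j r
    have h3 := pb_Kpm hc s i (serreElt D (-s) i j r)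
    rw [pb_QH_serreElt, pb_swap, mul_left_comm (Kpm D s i), ← mul_assoc, ← map_mul] at h3
    have e3 : -((s : ℤ) * (D.γ * D.d i)) * (-Complex.I * (((-s : ℤˣ) : ℤ) *
        (D.A i j + r * D.A i i))) = -(Complex.I * (D.γ * (D.d i * (D.A i j + 2 * r)))) := by
      rw [hD.diag]
      push_cast
      linear_combination -(Complex.I * (D.γ * (D.d i * (D.A i j + 2 * r)))) * units_sq s
    have e4 : conj (((s : ℤ) : ℂ) * D.c * D.γ * (D.d i * ((D.A i j : ℂ) + 2 * r))) =
        -((s : ℤ) * (Complex.I * (D.γ * (D.d i * (D.A i j + 2 * r))))) := by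
      simp only [map_mul, map_add, hD.conj_d, hc, Complex.conj_I, Complex.conj_ofReal, map_natCast,
        map_intCast, Complex.conj_ofNat]
      ring
    have e5 : (((-s : ℤˣ) : ℤ) : ℂ) * D.c * D.γ * (D.d i * ((D.A i j : ℂ) + 2 * r)) =
        -((s : ℤ) * (Complex.I * (D.γ * (D.d i * (D.A i j + 2 * r))))) := by
      rw [hc]; push_cast; ring
    rw [e3] at h3
    rw [const_mul_pb, pb_const_mul, pow_succ (Kpm D s i), ← mul_assoc (Kpm D s j), e4, e5,
      pow_succ, ← mul_assoc (((lam j : ℤ) : ℂ)), map_mul _ _ ((lam i : ℤ) : ℂ)]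
    generalize Kpm D s j * Kpm D s i ^ r = U at *
    rw [pb_mul, mul_pb, mul_pb, h1, h2]
    simp only [map_neg, map_mul _ ((s : ℤ) : ℂ)] at h3 ⊢
    -- `h3` gives `{S, K}` from the weight of `S`; its coefficient is the one already substituted by
    -- `h2`, with opposite sign.
    linear_combination (-algebraMap ℂ (Uq D) ((lam j : ℤ) * (lam i : ℤ) ^ r) *
      algebraMap ℂ (Uq D) ((lam i : ℤ) : ℂ) * U * QE D (-s) i) * h3

/-- The brackets of `Kinv_i` with `E_j` and of `K_j` with `E_{-i}` carry the same coefficient, by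
symmetry of `d_i A_ij`, and enter with opposite signs; only the bracket of the root generators
survives. -/
theorem pb_nonSplitGen_QE (hc : D.c = Complex.I) (hD : IsSymmetrized D) (lam : ι → ℤˣ) (i j : ι) :
    pb D (nonSplitGen D lam (.QE 1 i)) (nonSplitGen D lam (.QE (-1) j)) =
      -(algebraMap ℂ (Uq D) ((lam i : ℤ) : ℂ) * algebraMap ℂ (Uq D) ((lam j : ℤ) : ℂ) *
        (Kinv D i * K D j) * pb D (QE D 1 j) (QE D (-1) i)) := by
  have h1 := pb_Kpm hc 1 i (QE D 1 j)
  have h2 := pb_Kpm hc (-1) j (QE D (-1) i)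
  rw [pb_QH_QE, mul_left_comm (Kpm D _ _), ← mul_assoc, ← map_mul] at h1 h2
  have e1 : -(((1 : ℤˣ) : ℤ) * (D.γ * D.d i)) * (-Complex.I * (((1 : ℤˣ) : ℤ) * D.A i j)) =
      Complex.I * D.γ * (D.d i * D.A i j) := by push_cast; ring
  have e2 : -(((-1 : ℤˣ) : ℤ) * (D.γ * D.d j)) * (-Complex.I * (((-1 : ℤˣ) : ℤ) * D.A j i)) =
      Complex.I * D.γ * (D.d i * D.A i j) := by
    rw [hD.symm i j]; push_cast; ring
  rw [e1] at h1
  rw [e2, pb_swap] at h2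
  rw [Kpm_one] at h1
  rw [Kpm_neg_one] at h2
  simp only [nonSplitGen, Kpm_one, Kpm_neg_one, neg_neg]
  rw [const_mul_pb, pb_const_mul, mul_pb, pb_mul, pb_mul, h1, pb_Kinv_K,
    pb_swap (QE D (-1) i) (QE D 1 j)]
  linear_combination (-algebraMap ℂ (Uq D) ((lam i : ℤ) : ℂ) *
    algebraMap ℂ (Uq D) ((lam j : ℤ) : ℂ) * Kinv D i * QE D 1 j) * h2

theorem nonSplitGen_compatible (hc : D.c = Complex.I) (hD : IsSymmetrized D) (lam : ι → ℤˣ) :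
    IsConjCompatible (nonSplitGen D lam) where
  K_Kinv := K_mul_Kinv
  pb_K i x := by
    simp only [nonSplitGen]
    rw [pb_K, hc]
    simp only [map_mul, map_neg, hD.conj_d, Complex.conj_I, Complex.conj_ofReal]
    ring
  QH_QH i j := pb_QH_QH i j
  QH_QE s i j := by
    simp only [nonSplitGen]
    rw [pb_const_mul, pb_mul, pb_QH_Kpm, pb_QH_QE]
    simp only [map_mul, map_neg, Complex.conj_I, map_intCast, Units.val_neg, Int.cast_neg]
    linear_combination (-(s : ℤ) * D.A i j * (lam j : ℤ) * Kpm D s j * QE D (-s) j) *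
      algebraMap_I_sq (D := D)
  QE_QE_same i := by
    have h := pb_QE_same (D := D) i
    -- Here `q` is real; the sign of `conj I` is absorbed by the sign in `pb_nonSplitGen_QE`.
    have e : conj (qPow D.c D.γ (D.d i) - qPow D.c D.γ (-D.d i))⁻¹ =
        (qPow D.c D.γ (D.d i) - qPow D.c D.γ (-D.d i))⁻¹ := by
      rw [map_inv₀]
      congr 1
      simp only [qPow, map_sub, ← Complex.exp_conj, map_mul, map_neg, Complex.conj_I, hc,
        Complex.conj_ofReal, hD.conj_d]
      ring_nf
    rw [e, pb_nonSplitGen_QE hc hD]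
    simp only [nonSplitGen, map_neg, Complex.conj_I, map_one] at h ⊢
    linear_combination h + algebraMap ℂ (Uq D) Complex.I * pb D (QE D 1 i) (QE D (-1) i) *
      (algebraMap_lam_sq (lam i) + algebraMap ℂ (Uq D) ((lam i : ℤ) : ℂ) *
        algebraMap ℂ (Uq D) ((lam i : ℤ) : ℂ) * K_mul_Kinv i)
  QE_QE_ne i j h := by
    rw [pb_nonSplitGen_QE hc hD, pb_QE_ne h.symm]; simp
  serre s i j h := by
    rw [conjLift_nonSplitGen_serre hc hD, serreElt_eq_zero (-s) h, mul_zero, mul_zero]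

theorem existsUnique_isNonSplitForm (hc : D.c = Complex.I) (hD : IsSymmetrized D)
    (lam : ι → ℤˣ) : ∃! τ : Uq D →+* Uq D, IsNonSplitForm lam τ := by
  have hg := nonSplitGen_compatible hc hD lam
  have hK : ∀ s i, conjHom hg (Kpm D s i) = Kpm D s i := fun s i => by
    rcases Int.units_eq_one_or s with rfl | rfl <;> rfl
  have hreal : IsRealStructure (conjHom hg) := by
    refine isRealStructure_conjHom hg (fun i => rfl) (fun i => rfl) (fun s i => ?_)
    simp only [nonSplitGen]
    rw [map_mul, map_mul, hK, conjHom_algebraMap]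
    change _ * (_ * (algebraMap ℂ (Uq D) ((lam i : ℤ) : ℂ) * (Kpm D (-s) i * QE D (- -s) i))) = _
    rw [neg_neg, map_intCast]
    linear_combination QE D s i * algebraMap_lam_sq (lam i) +
      algebraMap ℂ (Uq D) ((lam i : ℤ) : ℂ) * algebraMap ℂ (Uq D) ((lam i : ℤ) : ℂ) * QE D s i *
        Kpm_mul_Kpm_neg s i
  refine ⟨conjHom hg, ⟨hreal, fun i => rfl, fun i => rfl, fun i => rfl, fun i => ?_⟩,
    fun τ hτ => ?_⟩
  · change nonSplitGen D lam (.QE (-1) i) = _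
    simp [nonSplitGen, Kpm_neg_one]
  · refine hτ.toIsRealStructure.ext hreal (fun i => hτ.QH i) (fun i => hτ.K i) (fun s i => ?_)
    change _ = nonSplitGen D lam (.QE s i)
    rcases Int.units_eq_one_or s with rfl | rfl
    · rw [hτ.QE_pos]; rfl
    · rw [hτ.QE_neg]; simp [nonSplitGen, Kpm_neg_one]

/-! ### Evaluation on functions -/

variable {M : Type*} {qh qep qem : ι → M → ℂ} {br : (M → ℂ) → (M → ℂ) → M → ℂ}
  {φ : Uq D →ₐ[ℂ] (M → ℂ)} {τ : Uq D →+* Uq D}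

theorem qPow_mul_qPow_neg (c : ℂ) (γ : ℝ) (x : ℂ) : qPow c γ x * qPow c γ (-x) = 1 := by
  rw [qPow, qPow, ← Complex.exp_add]; simp

theorem IsEvaluation.map_Kinv (hφ : IsEvaluation qh qep qem br φ) (i : ι) (x : M) :
    φ (Kinv D i) x = qPow D.c D.γ (-(D.d i * qh i x)) := by
  have h := congrFun (congrArg φ (K_mul_Kinv (D := D) i)) x
  rw [map_mul, map_one, Pi.mul_apply, hφ.K, Pi.one_apply] at h
  linear_combination qPow D.c D.γ (-(D.d i * qh i x)) * h -
    φ (Kinv D i) x * qPow_mul_qPow_neg D.c D.γ (D.d i * qh i x)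

/-- The elements on which `φ ∘ τ` agrees with conjugation of `φ` are closed under sums and products,
and under brackets because `br` commutes with conjugation. -/
theorem map_conj_of_generators (hφ : IsEvaluation qh qep qem br φ) (hτ : IsRealStructure τ)
    (hQH : ∀ i x, φ (τ (QH D i)) x = conj (φ (QH D i) x))
    (hK : ∀ i x, φ (τ (K D i)) x = conj (φ (K D i) x))
    (hQE : ∀ s i x, φ (τ (QE D s i)) x = conj (φ (QE D s i) x)) (a : Uq D) :
    ∀ x, φ (τ a) x = conj (φ a x) := by
  induction a using Uq.induction with
  | hs a => intro x; simp [hτ.antilinear]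
  | hQH i => exact hQH i
  | hK i => exact hK i
  | hKinv i =>
    intro x
    refine map_Kinv_of_map_K
      ((Pi.evalRingHom (fun _ : M => ℂ) x).comp ((φ : Uq D →+* (M → ℂ)).comp τ)) ?_
    change φ (τ (K D i)) x * _ = 1
    rw [hK, ← map_mul, ← Pi.mul_apply, ← map_mul, K_mul_Kinv]
    simp
  | hQE s i => exact hQE s i
  | hadd x y hx hy => intro z; simp [hx, hy]
  | hmul x y hx hy => intro z; simp [hx, hy]
  | hpb x y hx hy =>
    intro z
    rw [hτ.map_pb, hφ.map_pb, hφ.map_pb, ← hφ.br_conj, funext hx, funext hy]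

theorem IsSplitForm.map_conj (hτ : IsSplitForm τ) (hc : D.c = 1)
    (hd : ∀ i, conj (D.d i) = D.d i) (hφ : IsEvaluation qh qep qem br φ)
    (h0 : ∀ i x, conj (qh i x) = -qh i x) (hp : ∀ i x, conj (qep i x) = -qep i x)
    (hm : ∀ i x, conj (qem i x) = -qem i x) (a : Uq D) (x : M) : φ (τ a) x = conj (φ a x) := by
  refine map_conj_of_generators hφ hτ.toIsRealStructure (fun i x => ?_) (fun i x => ?_) (fun s i x => ?_) a x
  · simp [hτ.QH, hφ.QH, h0]
  · rw [hτ.K, hφ.K, qPow, ← Complex.exp_conj]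
    congr 1
    simp only [map_mul, map_neg, Complex.conj_I, Complex.conj_ofReal, hc, map_one, hd, h0]
    ring
  · rcases Int.units_eq_one_or s with rfl | rfl
    · simp [hτ.QE, hφ.QE_pos, hp]
    · simp [hτ.QE, hφ.QE_neg, hm]

theorem IsNonSplitForm.map_conj {lam : ι → ℤˣ} (hτ : IsNonSplitForm lam τ) (hc : D.c = Complex.I)
    (hd : ∀ i, conj (D.d i) = D.d i) (hφ : IsEvaluation qh qep qem br φ)
    (h0 : ∀ i x, conj (qh i x) = qh i x)
    (hp : ∀ i x, conj (qep i x) =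
      ((lam i : ℤ) : ℂ) * qPow D.c D.γ (-(D.d i * qh i x)) * qem i x)
    (hm : ∀ i x, conj (qem i x) = ((lam i : ℤ) : ℂ) * qPow D.c D.γ (D.d i * qh i x) * qep i x)
    (a : Uq D) (x : M) : φ (τ a) x = conj (φ a x) := by
  refine map_conj_of_generators hφ hτ.toIsRealStructure (fun i x => ?_) (fun i x => ?_) (fun s i x => ?_) a x
  · simp [hτ.QH, hφ.QH, h0]
  · rw [hτ.K, hφ.K, qPow, ← Complex.exp_conj]
    congr 1
    simp only [map_mul, map_neg, Complex.conj_I, Complex.conj_ofReal, hc, hd, h0]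
    ring
  · rcases Int.units_eq_one_or s with rfl | rfl
    · rw [hτ.QE_pos, map_mul, map_mul, AlgHom.commutes, hφ.QE_neg, hφ.QE_pos, hp, Pi.mul_apply,
        Pi.mul_apply, hφ.map_Kinv, mul_assoc]
      rfl
    · rw [hτ.QE_neg, map_mul, map_mul, AlgHom.commutes, hφ.QE_neg, hφ.QE_pos, hm, Pi.mul_apply,
        Pi.mul_apply, hφ.K, mul_assoc]
      rfl

end Uq

/-! ### Conjugation by exponentials -/

section BanachAlgebra

variable {𝔸 : Type*} [NormedRing 𝔸] [NormedAlgebra ℂ 𝔸] [CompleteSpace 𝔸]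

theorem hasSum_exp_clm_apply (l : 𝔸 →L[ℂ] 𝔸) (B : 𝔸) :
    HasSum (fun n : ℕ => (n.factorial : ℂ)⁻¹ • (l ^ n) B) (NormedSpace.exp l B) :=
  (NormedSpace.exp_series_hasSum_exp' (𝕂 := ℂ) l).mapL (ContinuousLinearMap.apply ℂ 𝔸 B)

theorem exp_mul_left_apply (A B : 𝔸) :
    NormedSpace.exp (ContinuousLinearMap.mul ℂ 𝔸 A) B = NormedSpace.exp A * B := by
  refine (hasSum_exp_clm_apply _ B).unique ?_
  convert! (NormedSpace.exp_series_hasSum_exp' (𝕂 := ℂ) A).mul_right B using 2 with n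
  rw [smul_mul_assoc]
  congr 1
  induction n with
  | zero => simp
  | succ n ih => rw [pow_succ', mul_apply_eq_comp, ih, pow_succ']; simp [mul_assoc]

theorem exp_mul_right_apply (A B : 𝔸) :
    NormedSpace.exp ((ContinuousLinearMap.mul ℂ 𝔸).flip A) B = B * NormedSpace.exp A := by
  refine (hasSum_exp_clm_apply _ B).unique ?_
  convert! (NormedSpace.exp_series_hasSum_exp' (𝕂 := ℂ) A).mul_left B using 2 with n
  rw [mul_smul_comm]
  congr 1
  induction n with
  | zero => simp
  | succ n ih => rw [pow_succ', mul_apply_eq_comp, ih, pow_succ]; simp [mul_assoc]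

/-- `ad A` is left multiplication by `A` plus right multiplication by `-A`; these commute, so its
exponential is the product of theirs. -/
theorem hasSum_exp_mul_mul_exp_neg (A B : 𝔸) :
    HasSum (fun n : ℕ => (n.factorial : ℂ)⁻¹ • ((ad ℂ 𝔸 A) ^ n) B)
      (NormedSpace.exp A * B * NormedSpace.exp (-A)) := by
  let l := ContinuousLinearMap.mul ℂ 𝔸 A
  let r := (ContinuousLinearMap.mul ℂ 𝔸).flip (-A)
  have hc : Commute l r := by
    ext x
    simp [l, r, mul_assoc]
  let _ : NormedAlgebra ℚ (𝔸 →L[ℂ] 𝔸) := NormedAlgebra.restrictScalars ℚ ℂ _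
  have h := hasSum_exp_clm_apply (l + r) B
  rw [NormedSpace.exp_add_of_commute hc, mul_apply_eq_comp,
    exp_mul_left_apply, exp_mul_right_apply, ← mul_assoc] at h
  convert! h using 2 with n
  congr 1
  induction n with
  | zero => simp
  | succ n ih =>
    rw [pow_succ', Module.End.mul_apply, ih, pow_succ', mul_apply_eq_comp, ad_apply,
      Ring.lie_def]
    simp [l, r, sub_eq_add_neg]

end BanachAlgebra

section Conj

variable {L : Type*} [LieRing L] [LieAlgebra ℂ L] {N : ℕ}
  {ρ : L →ₗ⁅ℂ⁆ Matrix (Fin N) (Fin N) ℂ}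

theorem hasSum_gexp_conj (X Y : L) :
    HasSum (fun n : ℕ => (n.factorial : ℂ)⁻¹ • ρ (((ad ℂ L X) ^ n) Y))
      ((gexp ρ X : Matrix (Fin N) (Fin N) ℂ) * ρ Y * ((gexp ρ X)⁻¹ : GL (Fin N) ℂ)) := by
  let _ : NormedRing (Matrix (Fin N) (Fin N) ℂ) := Matrix.linftyOpNormedRing
  let _ : NormedAlgebra ℂ (Matrix (Fin N) (Fin N) ℂ) := Matrix.linftyOpNormedAlgebra
  convert! hasSum_exp_mul_mul_exp_neg (ρ X) (ρ Y) using 2 with n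
  congr 1
  induction n with
  | zero => simp
  | succ n ih => rw [pow_succ', Module.End.mul_apply, ad_apply, LieHom.map_lie, ih]; simp [pow_succ']

variable (ρ) in
/-- `g` maps `Y` to `W` under the adjoint action. -/
def IsAd (g : GL (Fin N) ℂ) (Y W : L) : Prop :=
  (g : Matrix (Fin N) (Fin N) ℂ) * ρ Y = ρ W * g

theorem IsAd.mul {g g' : GL (Fin N) ℂ} {Y W V : L} (h' : IsAd ρ g' Y W) (h : IsAd ρ g W V) :
    IsAd ρ (g * g') Y V := by
  unfold IsAd at *
  rw [Units.val_mul, mul_assoc, h', ← mul_assoc, h, mul_assoc]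

theorem IsAd.one (Y : L) : IsAd ρ 1 Y Y := by simp [IsAd]

theorem IsAd.add {g : GL (Fin N) ℂ} {Y W Y' W' : L} (h : IsAd ρ g Y W) (h' : IsAd ρ g Y' W') :
    IsAd ρ g (Y + Y') (W + W') := by
  unfold IsAd at *
  rw [map_add, map_add, mul_add, add_mul, h, h']

theorem IsAd.smul {g : GL (Fin N) ℂ} {Y W : L} (a : ℂ) (h : IsAd ρ g Y W) :
    IsAd ρ g (a • Y) (a • W) := by
  unfold IsAd at *
  rw [map_smul, map_smul, Matrix.mul_smul, Matrix.smul_mul, h]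

theorem IsAd.unique (hρ : Function.Injective ρ) {g : GL (Fin N) ℂ} {Y W W' : L}
    (h : IsAd ρ g Y W) (h' : IsAd ρ g Y W') : W = W' := by
  unfold IsAd at *
  rw [h] at h'
  exact hρ (g.isUnit.mul_right_cancel h')

theorem gexp_neg (X : L) : gexp ρ (-X) = (gexp ρ X)⁻¹ := by
  ext1
  change NormedSpace.exp (ρ (-X)) = NormedSpace.exp (-ρ X)
  rw [map_neg]

/-- The tail of the exponential series lies in `ρ(S)`, which is closed because it is
finite-dimensional. Hence the limit is again in the image of `ρ`, and the error after `k` terms is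
in `S`. -/
theorem exists_isAd_gexp_sub_mem (X Y : L) (S : Submodule ℂ L) (k : ℕ)
    (hS : ∀ n, k ≤ n → ((ad ℂ L X) ^ n) Y ∈ S) : ∃ W, IsAd ρ (gexp ρ X) Y W ∧
      W - ∑ n ∈ Finset.range k, (n.factorial : ℂ)⁻¹ • ((ad ℂ L X) ^ n) Y ∈ S := by
  have h := (hasSum_nat_add_iff' k).mpr (hasSum_gexp_conj (ρ := ρ) X Y)
  set T : Submodule ℂ (Matrix (Fin N) (Fin N) ℂ) := S.map (ρ : L →ₗ[ℂ] _)
  have hT : IsClosed (T : Set (Matrix (Fin N) (Fin N) ℂ)) := T.closed_of_finiteDimensional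
  have hmem := hT.mem_of_tendsto h (Filter.Eventually.of_forall fun s => by
    refine T.sum_mem fun n _ => T.smul_mem _ ?_
    exact Submodule.mem_map_of_mem (hS _ (Nat.le_add_left _ _)))
  obtain ⟨V, hV, e⟩ := hmem
  refine ⟨V + ∑ n ∈ Finset.range k, (n.factorial : ℂ)⁻¹ • ((ad ℂ L X) ^ n) Y, ?_, by simpa⟩
  have e' : ρ V = _ := e
  rw [IsAd, map_add, e', map_sum]
  simp only [map_smul, sub_add_cancel]
  rw [mul_assoc, ← Units.val_mul, inv_mul_cancel, Units.val_one, mul_one]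

theorem exists_isAd_gexp (X Y : L) : ∃ W, IsAd ρ (gexp ρ X) Y W :=
  (exists_isAd_gexp_sub_mem X Y ⊤ 0 fun _ _ => Submodule.mem_top).imp fun _ h => h.1

/-- The adjoint action of an exponential is given by the exponential series, tested against real
linear maps to matrices. -/
theorem hasSum_of_isAd (hρ : Function.Injective ρ) {X Y W : L} (h : IsAd ρ (gexp ρ X) Y W)
    {V : Type*} [AddCommGroup V] [Module ℝ V] [TopologicalSpace V] [IsTopologicalAddGroup V]
    [ContinuousSMul ℝ V] (T : L →ₗ[ℝ] V) :
    HasSum (fun n : ℕ => (n.factorial : ℝ)⁻¹ • T (((ad ℂ L X) ^ n) Y)) (T W) := by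
  have hs := hasSum_gexp_conj (ρ := ρ) X Y
  rw [show (gexp ρ X : Matrix (Fin N) (Fin N) ℂ) * ρ Y = _ from h, mul_assoc, ← Units.val_mul,
    mul_inv_cancel, Units.val_one, mul_one] at hs
  -- A linear left inverse of `ρ` transports convergence from matrices to `L`, where no topology is
  -- given. Real scalars are used so that the semi-linear `θ` may occur in `T`.
  obtain ⟨p, hp⟩ := ((ρ : L →ₗ[ℂ] Matrix (Fin N) (Fin N) ℂ).restrictScalars ℝ).exists_leftInverse_of_injective
    (LinearMap.ker_eq_bot_of_injective hρ)
  have hp' : ∀ x, p (ρ x) = x := fun x => LinearMap.congr_fun hp x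
  have hc : Continuous (T ∘ₗ p) := LinearMap.continuous_of_finiteDimensional _
  have := hs.map (T ∘ₗ p) hc
  simp only [LinearMap.comp_apply, hp'] at this
  convert! this using 2 with n
  have e : (n.factorial : ℂ)⁻¹ • ρ (((ad ℂ L X) ^ n) Y) =
      (n.factorial : ℝ)⁻¹ • ρ (((ad ℂ L X) ^ n) Y) := by
    rw [← Complex.coe_smul]; push_cast; rfl
  simp [e, hp']

theorem isAd_gexp_of_lie_eq_smul {X Y : L} {a : ℂ} (h : ⁅X, Y⁆ = a • Y) :
    IsAd ρ (gexp ρ X) Y (Complex.exp a • Y) := by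
  have hn : ∀ n : ℕ, ((ad ℂ L X) ^ n) Y = a ^ n • Y := fun n => by
    induction n with
    | zero => simp
    | succ n ih => rw [pow_succ', Module.End.mul_apply, ih, map_smul, ad_apply, h, smul_smul, pow_succ]
  have h1 := hasSum_gexp_conj (ρ := ρ) X Y
  have h2 := (NormedSpace.exp_series_hasSum_exp' (𝕂 := ℂ) a).smul_const (ρ Y)
  have e := h1.unique (by
    convert! h2 using 2 with n
    rw [hn, map_smul, smul_assoc])
  rw [IsAd, map_smul, Complex.exp_eq_exp_ℂ, ← e, mul_assoc _ _ (gexp ρ X).val, ← Units.val_mul, inv_mul_cancel,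
    Units.val_one, mul_one]

/-- The dual version of `isAd_gexp_of_lie_eq_smul`: an eigenfunctional of `ad X` sees the
exponential as a scalar, whatever the vector `Y`. -/
theorem apply_isAd_gexp (hρ : Function.Injective ρ) {X Y W : L} {a : ℂ}
    (h : IsAd ρ (gexp ρ X) Y W) (T : L →ₗ[ℂ] ℂ) (hT : ∀ V, T ⁅X, V⁆ = a * T V) :
    T W = Complex.exp a * T Y := by
  have hn : ∀ n : ℕ, T (((ad ℂ L X) ^ n) Y) = a ^ n * T Y := fun n => by
    induction n with
    | zero => simp
    | succ n ih => rw [pow_succ', Module.End.mul_apply, ad_apply, hT, ih]; ring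
  have h1 := hasSum_of_isAd hρ h (T.restrictScalars ℝ)
  have h2 := (NormedSpace.exp_series_hasSum_exp' (𝕂 := ℝ) a).mul_right (T Y)
  rw [Complex.exp_eq_exp_ℂ]
  refine h1.unique ?_
  convert! h2 using 2 with n
  simp [hn, mul_assoc]

end Conj

/-! ### The filtration by the eigenvalues of a grading element -/

section Filtration

variable {L : Type*} [LieRing L] [LieAlgebra ℂ L] {N : ℕ}
  {ρ : L →ₗ⁅ℂ⁆ Matrix (Fin N) (Fin N) ℂ}

/-- The sum of the eigenspaces of `ad h` for the integers `j ≥ k`. -/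
def gradedFiltration (h : L) (k : ℤ) : Submodule ℂ L :=
  ⨆ j : {j : ℤ // k ≤ j}, (ad ℂ L h).eigenspace ((j : ℤ) : ℂ)

theorem mem_gradedFiltration {h x : L} {j k : ℤ} (hx : ⁅h, x⁆ = (j : ℂ) • x) (hj : k ≤ j) :
    x ∈ gradedFiltration h k :=
  Submodule.mem_iSup_of_mem (⟨j, hj⟩ : {j : ℤ // k ≤ j}) (Module.End.mem_eigenspace_iff.mpr hx)

theorem gradedFiltration_le {h : L} {k : ℤ} {S : Submodule ℂ L}
    (hS : ∀ (j : ℤ) x, k ≤ j → ⁅h, x⁆ = (j : ℂ) • x → x ∈ S) : gradedFiltration h k ≤ S :=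
  iSup_le fun j x hx => hS j x j.2 (Module.End.mem_eigenspace_iff.mp hx)

theorem gradedFiltration_anti (h : L) {k k' : ℤ} (hk : k ≤ k') :
    gradedFiltration h k' ≤ gradedFiltration h k :=
  gradedFiltration_le fun _ _ hj hx => mem_gradedFiltration hx (hk.trans hj)

theorem self_mem_gradedFiltration (h : L) : h ∈ gradedFiltration h 0 :=
  mem_gradedFiltration (j := 0) (by simp) le_rfl

theorem lie_mem_gradedFiltration {h x y : L} {j k : ℤ} (hx : x ∈ gradedFiltration h j)
    (hy : y ∈ gradedFiltration h k) : ⁅x, y⁆ ∈ gradedFiltration h (j + k) := by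
  have key : ∀ (a b : ℤ) (x y : L), j ≤ a → k ≤ b → ⁅h, x⁆ = (a : ℂ) • x → ⁅h, y⁆ = (b : ℂ) • y →
      ⁅x, y⁆ ∈ gradedFiltration h (j + k) := fun a b x y ha hb hx hy => by
    refine mem_gradedFiltration (j := a + b) ?_ (add_le_add ha hb)
    rw [leibniz_lie, hx, hy, smul_lie, lie_smul, ← add_smul]
    push_cast; rfl
  -- The filtration is a supremum, so bilinearity is used one variable at a time.
  have h1 : ∀ (b : ℤ) (y : L), k ≤ b → ⁅h, y⁆ = (b : ℂ) • y →
      gradedFiltration h j ≤ (gradedFiltration h (j + k)).comap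
        ((toEnd ℂ L L : L →ₗ[ℂ] Module.End ℂ L).flip y) := fun b y hb hy =>
    gradedFiltration_le fun a x ha hx => key a b x y ha hb hx hy
  have h2 : gradedFiltration h k ≤ (gradedFiltration h (j + k)).comap (ad ℂ L x) :=
    gradedFiltration_le fun b y hb hy => h1 b y hb hy hx
  exact h2 hy

theorem ad_pow_mem_gradedFiltration {h x y : L} {k : ℤ} (hx : x ∈ gradedFiltration h 1)
    (hy : y ∈ gradedFiltration h k) (n : ℕ) : ((ad ℂ L x) ^ n) y ∈ gradedFiltration h (k + n) := by
  induction n with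
  | zero => simpa using hy
  | succ n ih =>
    rw [pow_succ', Module.End.mul_apply, ad_apply]
    have := lie_mem_gradedFiltration hx ih
    rwa [show 1 + (k + n) = k + ((n + 1 : ℕ) : ℤ) by push_cast; ring] at this

theorem exists_isAd_gexp_of_mem_gradedFiltration {h x y : L} {k : ℤ}
    (hx : x ∈ gradedFiltration h 1) (hy : y ∈ gradedFiltration h k) :
    ∃ W, IsAd ρ (gexp ρ x) y W ∧ W - y ∈ gradedFiltration h (k + 1) := by
  obtain ⟨W, h1, h2⟩ := exists_isAd_gexp_sub_mem (ρ := ρ) x y (gradedFiltration h (k + 1)) 1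
    fun n hn => gradedFiltration_anti h (by exact_mod_cast add_le_add_right (by exact_mod_cast hn) k)
      (ad_pow_mem_gradedFiltration hx hy n)
  exact ⟨W, h1, by simpa using h2⟩

/-- The first-order term is kept because it is the degree-one part, where the charge sits; all
higher terms have degree at least two. -/
theorem exists_isAd_gexp_self {h x : L} (hx : x ∈ gradedFiltration h 1) :
    ∃ W, IsAd ρ (gexp ρ x) h W ∧ W - (h + ⁅x, h⁆) ∈ gradedFiltration h 2 := by
  obtain ⟨W, h1, h2⟩ := exists_isAd_gexp_sub_mem (ρ := ρ) x h (gradedFiltration h 2) 2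
    fun n hn => gradedFiltration_anti h (by simpa using hn)
      (ad_pow_mem_gradedFiltration hx (self_mem_gradedFiltration h) n)
  exact ⟨W, h1, by simpa [Finset.sum_range_succ] using h2⟩

theorem exists_isAd_prod_gexp {h : L} {l : List L} (hl : ∀ x ∈ l, x ∈ gradedFiltration h 1)
    {y : L} {k : ℤ} (hy : y ∈ gradedFiltration h k) :
    ∃ W, IsAd ρ (l.map (gexp ρ)).prod y W ∧ W - y ∈ gradedFiltration h (k + 1) := by
  induction l with
  | nil => exact ⟨y, by simpa using IsAd.one y, by simp⟩
  | cons x l ih =>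
    obtain ⟨W, h1, h2⟩ := ih fun z hz => hl z (List.mem_cons_of_mem _ hz)
    have hW : W ∈ gradedFiltration h k := by
      simpa using add_mem (gradedFiltration_anti h (by lia : k ≤ k + 1) h2) hy
    obtain ⟨V, h3, h4⟩ := exists_isAd_gexp_of_mem_gradedFiltration (ρ := ρ)
      (hl x List.mem_cons_self) hW
    exact ⟨V, by simpa using h1.mul h3, by simpa using add_mem h4 h2⟩

/-- Modulo degree two the product sees only the sum of its exponents, so the order of the factors
plays no role: a further factor contributes its own linear term on `h` and acts trivially on the
correction already in degree one. -/
theorem exists_isAd_prod_gexp_self {h : L} {l : List L} (hl : ∀ x ∈ l, x ∈ gradedFiltration h 1) :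
    ∃ W, IsAd ρ (l.map (gexp ρ)).prod h W ∧ W - (h + ⁅l.sum, h⁆) ∈ gradedFiltration h 2 := by
  induction l with
  | nil => exact ⟨h, by simpa using IsAd.one h, by simp⟩
  | cons x l ih =>
    have hl' : ∀ z ∈ l, z ∈ gradedFiltration h 1 := fun z hz => hl z (List.mem_cons_of_mem _ hz)
    obtain ⟨W, h1, h2⟩ := ih hl'
    have hx := hl x List.mem_cons_self
    have hs : ⁅l.sum, h⁆ ∈ gradedFiltration h 1 :=
      lie_mem_gradedFiltration (j := 1) (k := 0) (list_sum_mem hl') (self_mem_gradedFiltration h)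
    have hu : W - h ∈ gradedFiltration h 1 := by
      have := add_mem (gradedFiltration_anti h (by norm_num : (1 : ℤ) ≤ 2) h2) hs
      rwa [show W - (h + ⁅l.sum, h⁆) + ⁅l.sum, h⁆ = W - h by abel] at this
    obtain ⟨V, h3, h4⟩ := exists_isAd_gexp_self (ρ := ρ) hx
    obtain ⟨U, h5, h6⟩ := exists_isAd_gexp_of_mem_gradedFiltration (ρ := ρ) hx hu
    refine ⟨V + U, ?_, ?_⟩
    · have := h1.mul (g := gexp ρ x) (V := V + U) (by simpa using h3.add h5)
      simpa using this
    · have := add_mem (add_mem h2 h4) h6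
      rw [List.sum_cons, add_lie]
      convert! this using 1
      abel

end Filtration

/-! ### Pairs of group elements intertwined by a semi-linear involution -/

section Twist

variable {L : Type*} [LieRing L] [LieAlgebra ℂ L] {N : ℕ}
  {ρ : L →ₗ⁅ℂ⁆ Matrix (Fin N) (Fin N) ℂ}

/-- A semi-linear involution as a real linear map. -/
def SemilinearInvolution.toRealLinear (θ : SemilinearInvolution L) : L →ₗ[ℝ] L where
  toFun := θ.toMap
  map_add' := θ.toMap.map_add
  map_smul' r x := by
    rw [← Complex.coe_smul, θ.toMap.map_smulₛₗ, Complex.conj_ofReal, Complex.coe_smul]; rfl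

variable (ρ) in
/-- The involution `θ` intertwines the adjoint actions of `g` and `g'`. -/
def IsTwisted (θ : SemilinearInvolution L) (g g' : GL (Fin N) ℂ) : Prop :=
  ∀ Y, ∃ W, IsAd ρ g Y W ∧ IsAd ρ g' (θ.toMap Y) (θ.toMap W)

theorem IsTwisted.one (θ : SemilinearInvolution L) : IsTwisted ρ θ 1 1 :=
  fun Y => ⟨Y, IsAd.one _, IsAd.one _⟩

theorem IsTwisted.mul {θ : SemilinearInvolution L} {g g' k k' : GL (Fin N) ℂ}
    (h : IsTwisted ρ θ g g') (hk : IsTwisted ρ θ k k') : IsTwisted ρ θ (g * k) (g' * k') := by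
  intro Y
  obtain ⟨W, h1, h2⟩ := hk Y
  obtain ⟨V, h3, h4⟩ := h W
  exact ⟨V, h1.mul h3, h2.mul h4⟩

/-- `θ` intertwines the powers of `ad X` and `ad X'`, and being real linear in finite dimension it
passes through the exponential series. -/
theorem isTwisted_gexp (hρ : Function.Injective ρ) (θ : SemilinearInvolution L) {X X' : L}
    (hX : θ.toMap X = X') : IsTwisted ρ θ (gexp ρ X) (gexp ρ X') := by
  intro Y
  obtain ⟨W, h1⟩ := exists_isAd_gexp (ρ := ρ) X Y
  obtain ⟨W', h2⟩ := exists_isAd_gexp (ρ := ρ) X' (θ.toMap Y)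
  refine ⟨W, h1, ?_⟩
  have e1 := hasSum_of_isAd hρ h1
    (((ρ : L →ₗ[ℂ] Matrix (Fin N) (Fin N) ℂ).restrictScalars ℝ) ∘ₗ θ.toRealLinear)
  have e2 := hasSum_of_isAd hρ h2 ((ρ : L →ₗ[ℂ] Matrix (Fin N) (Fin N) ℂ).restrictScalars ℝ)
  have hn : ∀ n : ℕ, θ.toMap (((ad ℂ L X) ^ n) Y) = ((ad ℂ L X') ^ n) (θ.toMap Y) := fun n => by
    induction n with
    | zero => rfl
    | succ n ih =>
      rw [pow_succ', Module.End.mul_apply, ad_apply, θ.map_lie, ih, hX, pow_succ',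
        Module.End.mul_apply, ad_apply]
  have e : ρ (θ.toMap W) = ρ W' := by
    refine e1.unique ?_
    convert! e2 using 3 with n
    exact congrArg ρ (hn n)
  rwa [hρ e]

variable [FiniteDimensional ℂ L] [IsKilling ℂ L]
  {H : LieSubalgebra ℂ L} [H.IsCartanSubalgebra] {b : (rootSystem H).Base}

/-- For a fixed point `X`, `θ` sends `RX ± cX` to `RX ± conj c X`. This is the same generator
component for real `c` and the other component for imaginary `c`; products and inverses inherit the
property. -/
theorem isTwisted_of_mem_dualGroup (hρ : Function.Injective ρ) {E : Weight ℂ H L → L}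
    {θ : SemilinearInvolution L} {c : ℂ} (hR : ∀ X, θ.toMap (stdR b E c X) = stdR b E c (θ.toMap X))
    {p : GL (Fin N) ℂ × GL (Fin N) ℂ} (hp : p ∈ dualGroup b ρ E θ c) :
    (conj c = c → IsTwisted ρ θ p.1 p.1 ∧ IsTwisted ρ θ p.2 p.2) ∧
      (conj c = -c → IsTwisted ρ θ p.1 p.2) := by
  have hmul : ∀ X, θ.toMap X = X → ∀ a : ℂ, θ.toMap (a • X) = conj a • X := fun X hX a => by
    rw [θ.toMap.map_smulₛₗ, hX]
  induction hp using Subgroup.closure_induction'' with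
  | mem p hp =>
    obtain ⟨X, hX, rfl⟩ := hp
    refine ⟨fun hc => ⟨isTwisted_gexp hρ θ ?_, isTwisted_gexp hρ θ ?_⟩,
      fun hc => isTwisted_gexp hρ θ ?_⟩
    · rw [map_add, hR, hX, hmul X hX, hc]
    · rw [map_sub, hR, hX, hmul X hX, hc]
    · rw [map_add, hR, hX, hmul X hX, hc, neg_smul, sub_eq_add_neg]
  | inv_mem p hp =>
    obtain ⟨X, hX, rfl⟩ := hp
    simp only [Prod.fst_inv, Prod.snd_inv, ← gexp_neg]
    refine ⟨fun hc => ⟨isTwisted_gexp hρ θ ?_, isTwisted_gexp hρ θ ?_⟩,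
      fun hc => isTwisted_gexp hρ θ ?_⟩
    · rw [map_neg, map_add, hR, hX, hmul X hX, hc]
    · rw [map_neg, map_sub, hR, hX, hmul X hX, hc]
    · rw [map_neg, map_add, hR, hX, hmul X hX, hc, neg_smul, sub_eq_add_neg]
  | one => exact ⟨fun _ => ⟨IsTwisted.one θ, IsTwisted.one θ⟩, fun _ => IsTwisted.one θ⟩
  | mul p q _ _ h1 h2 =>
    exact ⟨fun hc => ⟨(h1.1 hc).1.mul (h2.1 hc).1, (h1.1 hc).2.mul (h2.1 hc).2⟩,
      fun hc => (h1.2 hc).mul (h2.2 hc)⟩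

end Twist

/-! ### Root spaces, the invariant form, and involutions compatible with them. -/

section RootData

theorem rootSpace_induction {L : Type*} [LieRing L] [LieAlgebra ℂ L] [FiniteDimensional ℂ L]
    {H : LieSubalgebra ℂ L} [H.IsCartanSubalgebra] {P : L → Prop} (h0 : P 0) (hadd : ∀ x y, P x → P y → P (x + y))
    (h : ∀ (χ : Weight ℂ H L) (x : L), x ∈ rootSpace H χ → P x) (x : L) : P x := by
  have hx : x ∈ ⨆ χ : Weight ℂ H L, (rootSpace H χ).toSubmodule := by
    rw [LieSubmodule.iSup_toSubmodule_eq_top.mpr (iSup_genWeightSpace_eq_top' ℂ H L)]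
    trivial
  exact Submodule.iSup_induction (fun χ : Weight ℂ H L => (rootSpace H χ).toSubmodule) (motive := P)
    hx h h0 hadd

variable {L : Type*} [LieRing L] [LieAlgebra ℂ L] [FiniteDimensional ℂ L] [IsKilling ℂ L]
  {H : LieSubalgebra ℂ L} [H.IsCartanSubalgebra] (b : (rootSystem H).Base)

/-! ### Simple roots and the invariant form -/

theorem simple_isNonZero (i : b.support) : (simple b i).IsNonZero :=
  LieSubalgebra.isNonZero_coe_root (i : H.root)

theorem killingForm_dual_symm (f : Module.Dual ℂ H) (x : H) :
    killingForm ℂ L ((cartanEquivDual H).symm f : L) (x : L) = f x :=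
  LinearMap.BilinForm.apply_toDual_symm_apply (hB := traceForm_cartan_nondegenerate ℂ L H) _ _

theorem killingForm_simpleH (i : b.support) (x : H) :
    killingForm ℂ L (simpleH b i : L) (x : L) = simple b i x :=
  killingForm_dual_symm _ x

theorem simple_simpleH_self (i : b.support) : simple b i (simpleH b i) = 2 * dSym b i := by
  rw [← killingForm_simpleH, dSym]; ring

theorem dSym_ne_zero (i : b.support) : dSym b i ≠ 0 := fun h => by
  refine root_apply_cartanEquivDual_symm_ne_zero (simple_isNonZero b i) ?_
  have := simple_simpleH_self b i
  rwa [h, mul_zero] at this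

theorem simpleH_eq (i : b.support) : simpleH b i = dSym b i • coroot (simple b i) := by
  have h : simple b i ((cartanEquivDual H).symm (simple b i).toLinear) = 2 * dSym b i :=
    simple_simpleH_self b i
  rw [coroot, h, ← Nat.cast_smul_eq_nsmul ℂ, smul_smul, smul_smul]
  have : dSym b i * (2 : ℕ) * (2 * dSym b i)⁻¹ = 1 := by
    have := dSym_ne_zero b i
    push_cast
    field_simp
  rw [this, one_smul, simpleH]

theorem weight_simpleH (χ : Weight ℂ H L) (i : b.support) :
    ∃ n : ℤ, χ (simpleH b i) = dSym b i * n := by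
  have h := apply_coroot_eq_cast (simple b i) χ
  exact ⟨_, by rw [simpleH_eq, ← Weight.toLinear_apply, map_smul, Weight.toLinear_apply, h,
    smul_eq_mul]⟩

/-- Compute `κ(α_i^∨, α_i^∨)` twice: it equals `2 / d_i` by the definition of the coroot, and as a
trace it is a sum of squares of the integers `α(α_i^∨)`. -/
theorem exists_dSym_eq_ofReal (i : b.support) : ∃ r : ℝ, 0 < r ∧ dSym b i = r := by
  have h1 := traceForm_coroot (simple b i) (coroot (simple b i))
  have h2 := congrArg (fun B => B (coroot (simple b i)) (coroot (simple b i)))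
    (restrict_killingForm_eq_sum (K := ℂ) (L := L) (H := H))
  rw [root_apply_coroot (simple_isNonZero b i),
    show simple b i ((cartanEquivDual H).symm (simple b i).toLinear) = 2 * dSym b i from
      simple_simpleH_self b i] at h1
  have h3 : ∀ α : Weight ℂ H L, ∃ n : ℤ, α (coroot (simple b i)) = n := fun α =>
    ⟨_, apply_coroot_eq_cast (simple b i) α⟩
  choose n hn using h3
  have h4 : (2 : ℂ) / dSym b i = ((∑ α ∈ H.root, (n α : ℝ) ^ 2 : ℝ) : ℂ) := by
    have e : (2 : ℂ) / dSym b i = 2 • ((2 * dSym b i)⁻¹ • (2 : ℂ)) := by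
      have := dSym_ne_zero b i
      simp only [smul_eq_mul, nsmul_eq_mul]
      push_cast
      field_simp
    rw [e, ← h1]
    refine Eq.trans h2 ?_
    have hn' : ∀ α : Weight ℂ H L, Weight.toLinear ℂ H L α (coroot (simple b i)) = n α := hn
    simp [LinearMap.sum_apply, hn', sq]
  set S : ℝ := ∑ α ∈ H.root, (n α : ℝ) ^ 2
  have hd := dSym_ne_zero b i
  have hS : S ≠ 0 := fun h => by
    rw [h, Complex.ofReal_zero, div_eq_zero_iff] at h4
    simp_all
  have hS' : 0 ≤ S := Finset.sum_nonneg fun _ _ => sq_nonneg _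
  refine ⟨2 / S, div_pos two_pos (lt_of_le_of_ne hS' hS.symm), ?_⟩
  push_cast
  rw [← h4]
  field_simp

theorem conj_dSym (i : b.support) : conj (dSym b i) = dSym b i := by
  obtain ⟨r, -, h⟩ := exists_dSym_eq_ofReal b i
  rw [h, Complex.conj_ofReal]

theorem cartan_cast (i j : b.support) : (cartan b i j : ℂ) = simple b j (coroot (simple b i)) := by
  have := (rootSystem H).algebraMap_pairingIn ℤ (j : H.root) (i : H.root)
  rw [rootSystem_pairing_apply] at this
  exact this

theorem isSymmetrized_uqParam (c : ℂ) (γ : ℝ) : Uq.IsSymmetrized (uqParam b c γ) where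
  conj_d := conj_dSym b
  diag i := by
    have h := cartan_cast b i i
    rw [root_apply_coroot (simple_isNonZero b i)] at h
    exact_mod_cast h
  symm i j := by
    -- Both sides equal `κ(H_i, H_j)`.
    have h : ∀ i j : b.support, dSym b i * cartan b i j =
        killingForm ℂ L (simpleH b j : L) (simpleH b i : L) := fun i j => by
      rw [killingForm_simpleH, simpleH_eq b i, cartan_cast, ← Weight.toLinear_apply,
        ← Weight.toLinear_apply, map_smul, smul_eq_mul]
    change dSym b i * cartan b i j = dSym b j * cartan b j i
    rw [h, h, traceForm_comm]

theorem simple_fundP (i j : b.support) :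
    simple b i (fundP b j) = open Classical in if i = j then dSym b i else 0 := by
  classical
  rw [← killingForm_simpleH, traceForm_comm]
  change killingForm ℂ L ((cartanEquivDual H).symm (b.toCoweightBasis.coord j) : L) _ = _
  rw [killingForm_dual_symm, simpleH_eq, map_smul]
  have : b.toCoweightBasis i = coroot (simple b i) := b.toCoweightBasis_apply i
  rw [← this, Module.Basis.coord_apply, Module.Basis.repr_self, Finsupp.single_apply]
  simp

theorem simple_cartanZ (c : ℂ) (γ : ℝ) (Q : b.support → ℂ) (i : b.support) :
    simple b i (cartanZ b c γ Q) = Complex.I * c * γ * (dSym b i * Q i) := by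
  rw [cartanZ, ← Weight.toLinear_apply, map_smul, map_sum, smul_eq_mul]
  congr 1
  rw [Finset.sum_eq_single i]
  · rw [map_smul, Weight.toLinear_apply, simple_fundP, if_pos rfl, smul_eq_mul, mul_comm]
  · intro j _ hj
    rw [map_smul, Weight.toLinear_apply, simple_fundP, if_neg hj.symm, smul_zero]
  · simp

/-! ### The grading element -/

/-- The element of the Cartan subalgebra on which every root takes its height as value. -/
def heightElt : H := (Module.evalEquiv ℂ H).symm (b.toWeightBasis.constr ℂ fun _ => (1 : ℂ))

theorem dual_heightElt (f : Module.Dual ℂ H) :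
    f (heightElt b) = b.toWeightBasis.constr ℂ (fun _ => (1 : ℂ)) f := by
  rw [heightElt, Module.apply_evalEquiv_symm_apply]

theorem root_heightElt (α : H.root) : (α : Weight ℂ H L) (heightElt b) = (b.height α : ℂ) := by
  obtain ⟨f, -, -, hf⟩ := b.exists_root_eq_sum_int α
  rw [RootPairing.Base.height_eq_sum hf, ← Weight.toLinear_apply, dual_heightElt,
    show (α : Weight ℂ H L).toLinear = (rootSystem H).root α from rfl, hf, map_sum, Int.cast_sum]
  refine Finset.sum_congr rfl fun j hj => ?_
  rw [map_zsmul, ← b.toWeightBasis_apply ⟨j, hj⟩, Module.Basis.constr_basis]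
  simp

theorem simple_heightElt (i : b.support) : simple b i (heightElt b) = 1 := by
  have h := root_heightElt b (i : H.root)
  rw [RootPairing.Base.height_one_of_mem_support i.2, Int.cast_one] at h
  exact h

/-- The opposite of a root. -/
def negRoot (α : H.root) : H.root := ⟨-α.1, 
  Finset.mem_filter.mpr ⟨Finset.mem_univ _,
    Weight.isNonZero_neg.mpr (LieSubalgebra.isNonZero_coe_root α)⟩⟩

theorem negRoot_heightElt (α : H.root) : b.height (negRoot α) = -b.height α := by
  have h := root_heightElt b (negRoot α)
  have h' := root_heightElt b α
  rw [negRoot, Weight.coe_neg, Pi.neg_apply, h'] at h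
  exact_mod_cast h.symm

theorem isPos_or_isPos_negRoot (α : H.root) : b.IsPos α ∨ b.IsPos (negRoot α) := by
  have h := b.height_ne_zero α
  rw [RootPairing.Base.isPos_iff, RootPairing.Base.isPos_iff, negRoot_heightElt]
  lia

theorem neg_ne_of_isPos {α β : H.root} (hα : b.IsPos α) (hβ : b.IsPos β) : -β.1 ≠ α.1 := by
  intro h
  have : negRoot β = α := Subtype.ext h
  rw [RootPairing.Base.isPos_iff] at hα hβ
  rw [← this, negRoot_heightElt] at hα
  lia

theorem eq_zero_of_simple_eq_zero {x : H} (h : ∀ i, simple b i x = 0) : x = 0 := by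
  refine (Module.forall_dual_apply_eq_zero_iff ℂ x).mp fun f => ?_
  have : Module.Dual.eval ℂ H x = 0 := b.toWeightBasis.ext fun i => by
    rw [b.toWeightBasis_apply]; exact h i
  exact LinearMap.congr_fun this f

/-- The Killing duals of the simple roots form a basis of the Cartan subalgebra. -/
def simpleHBasis : Module.Basis b.support ℂ H := b.toWeightBasis.map (cartanEquivDual H).symm

theorem simpleHBasis_apply (i : b.support) : simpleHBasis b i = simpleH b i := by
  rw [simpleHBasis, Module.Basis.map_apply, b.toWeightBasis_apply]; rfl

/-! ### Root vectors -/

theorem lie_of_mem_rootSpace {χ : H → ℂ} {x : L} (h : x ∈ rootSpace H χ) (z : H) :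
    ⁅(z : L), x⁆ = χ z • x := lie_eq_smul_of_mem_rootSpace h z

variable {E : Weight ℂ H L → L}

theorem killingForm_of_ne (hE : IsRootVectors E) {χ α : Weight ℂ H L} (hα : α.IsNonZero)
    (hχ : χ ≠ -α) {x : L} (hx : x ∈ rootSpace H χ) : killingForm ℂ L (E α) x = 0 := by
  refine killingForm_apply_eq_zero_of_mem_rootSpace_of_add_ne_zero ℂ L H (hE.mem α hα) hx ?_
  intro h
  refine hχ (DFunLike.coe_injective ?_)
  rw [Weight.coe_neg]
  exact (neg_eq_of_add_eq_zero_right h).symm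

theorem killingForm_neg_self (hE : IsRootVectors E) {α : Weight ℂ H L} (hα : α.IsNonZero) :
    killingForm ℂ L (E (-α)) (E α) = 1 := by
  rw [traceForm_comm]; exact hE.norm α hα

theorem exists_eq_smul_rootVector (hE : IsRootVectors E) {α : Weight ℂ H L} (hα : α.IsNonZero)
    {x : L} (hx : x ∈ rootSpace H α) : ∃ a : ℂ, x = a • E α := by
  have hne : (⟨E α, hE.mem α hα⟩ : rootSpace H α) ≠ 0 := fun h => by
    have h0 : E α = 0 := congrArg Subtype.val h
    have := hE.norm α hα
    simp [h0] at this
  obtain ⟨a, ha⟩ := (finrank_eq_one_iff_of_nonzero' _ hne).mp (finrank_rootSpace_eq_one α hα) ⟨x, hx⟩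
  exact ⟨a, (congrArg Subtype.val ha).symm⟩

theorem lie_simple_rootVectors (hE : IsRootVectors E) (i : b.support) :
    ⁅E (simple b i), E (-simple b i)⁆ = (simpleH b i : L) := by
  have h := simple_isNonZero b i
  have hm := hE.mem _ (Weight.isNonZero_neg.mpr h)
  rw [Weight.coe_neg] at hm
  rw [lie_eq_killingForm_smul_of_mem_rootSpace_of_mem_rootSpace_neg (hE.mem _ h) hm,
    hE.norm _ h, one_smul]
  rfl

/-! ### The standard `R`-matrix on root spaces -/

theorem stdR_apply (E : Weight ℂ H L → L) (c : ℂ) (x : L) : stdR b E c x =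
    open Classical in c • ∑ α : H.root, if b.IsPos α then
      killingForm ℂ L (E (-α.1)) x • E α.1 - killingForm ℂ L (E α.1) x • E (-α.1) else 0 := by
  classical
  rw [stdR, LinearMap.smul_apply, LinearMap.sum_apply]
  congr 1
  refine Finset.sum_congr rfl fun α _ => ?_
  split_ifs <;> simp

theorem stdR_of_isZero (hE : IsRootVectors E) (c : ℂ) {χ : Weight ℂ H L} (hχ : χ.IsZero) {x : L}
    (hx : x ∈ rootSpace H χ) : stdR b E c x = 0 := by
  have h : ∀ α : Weight ℂ H L, α.IsNonZero → killingForm ℂ L (E α) x = 0 := fun α hα =>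
    killingForm_of_ne hE hα (fun e => hα (by
      rw [← Weight.isZero_neg, ← e]; exact hχ)) hx
  rw [stdR_apply]
  refine smul_eq_zero_of_right _ (Finset.sum_eq_zero fun α _ => ?_)
  have hα := LieSubalgebra.isNonZero_coe_root α
  rw [h _ hα, h _ (Weight.isNonZero_neg.mpr hα)]
  simp

theorem stdR_of_isPos (hE : IsRootVectors E) (c : ℂ) {α : H.root} (hα : b.IsPos α) {x : L}
    (hx : x ∈ rootSpace H α.1) : stdR b E c x = c • x := by
  obtain ⟨a, rfl⟩ := exists_eq_smul_rootVector hE (LieSubalgebra.isNonZero_coe_root α) hx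
  rw [stdR_apply, Finset.sum_eq_single α]
  · rw [if_pos hα, map_smul, map_smul, killingForm_neg_self hE (LieSubalgebra.isNonZero_coe_root α),
      killingForm_of_ne hE (LieSubalgebra.isNonZero_coe_root α) (neg_ne_of_isPos b hα hα).symm
        (hE.mem _ (LieSubalgebra.isNonZero_coe_root α))]
    simp
  · intro β _ hβ
    have hβ0 := LieSubalgebra.isNonZero_coe_root β
    split_ifs with h
    · rw [killingForm_of_ne hE (Weight.isNonZero_neg.mpr hβ0) (fun e => hβ ?_) hx,
        killingForm_of_ne hE hβ0 (neg_ne_of_isPos b hα h).symm hx]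
      · simp
      · rw [neg_neg] at e; exact Subtype.ext e.symm
    · rfl
  · simp

theorem stdR_of_isPos_neg (hE : IsRootVectors E) (c : ℂ) {α : H.root} (hα : b.IsPos α) {x : L}
    (hx : x ∈ rootSpace H (-α.1 : Weight ℂ H L)) : stdR b E c x = -(c • x) := by
  have hα0 := LieSubalgebra.isNonZero_coe_root α
  have hα1 := Weight.isNonZero_neg.mpr hα0
  obtain ⟨a, rfl⟩ := exists_eq_smul_rootVector hE hα1 hx
  rw [stdR_apply, Finset.sum_eq_single α]
  · rw [if_pos hα, map_smul, map_smul, hE.norm _ hα0,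
      killingForm_of_ne hE hα1 (by rw [neg_neg]; exact neg_ne_of_isPos b hα hα)
        (hE.mem _ hα1)]
    simp
  · intro β _ hβ
    have hβ0 := LieSubalgebra.isNonZero_coe_root β
    split_ifs with h
    · rw [killingForm_of_ne hE hβ0 (fun e => hβ ?_) hx,
        killingForm_of_ne hE (Weight.isNonZero_neg.mpr hβ0)
          (by rw [neg_neg]; exact neg_ne_of_isPos b h hα) hx]
      · simp
      · exact Subtype.ext (neg_injective e).symm
    · rfl
  · simp

/-! ### Semi-linear involutions that respect the Cartan decomposition -/

variable {b} {θ : SemilinearInvolution L}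

/-- Weights take real values on the `H_i`, so the antilinearity of `θ` does not disturb eigenvalues
there, and the `H_i` form a basis of the Cartan subalgebra. -/
theorem theta_mem_rootSpace {ε : ℤˣ} (hθ : ∀ i, θ.toMap (simpleH b i : L) =
    ((ε : ℤ) : ℂ) • (simpleH b i : L)) {χ : Weight ℂ H L} {x : L} (hx : x ∈ rootSpace H χ) :
    θ.toMap x ∈ rootSpace H (((ε : ℤ) : ℂ) • (χ : H → ℂ)) := by
  let f : H →ₗ[ℂ] L := ((toEnd ℂ L L : L →ₗ[ℂ] Module.End ℂ L).flip (θ.toMap x)) ∘ₗ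
    H.toSubmodule.subtype
  let g : H →ₗ[ℂ] L := (((ε : ℤ) : ℂ) • χ.toLinear).smulRight (θ.toMap x)
  have hfg : f = g := (simpleHBasis b).ext fun i => by
    rw [simpleHBasis_apply]
    change ⁅(simpleH b i : L), θ.toMap x⁆ = (((ε : ℤ) : ℂ) * χ (simpleH b i)) • θ.toMap x
    have h1 := congrArg θ.toMap (lie_of_mem_rootSpace hx (simpleH b i))
    obtain ⟨n, hn⟩ := weight_simpleH b χ i
    rw [θ.map_lie, hθ, θ.toMap.map_smulₛₗ, hn, map_mul, conj_dSym, map_intCast, ← hn,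
      smul_lie] at h1
    rw [mul_smul, ← h1, smul_smul, Uq.units_sq, one_smul]
  refine (mem_genWeightSpace L _ _).mpr fun z => ⟨1, ?_⟩
  have : ⁅z, θ.toMap x⁆ = (((ε : ℤ) : ℂ) • (χ : H → ℂ)) z • θ.toMap x := LinearMap.congr_fun hfg z
  rw [pow_one, LinearMap.sub_apply, toEnd_apply_apply, this]
  simp

/-- `R` is `c`, `-c`, `0` on positive, negative and zero weight spaces. For `ε = 1` these are
preserved and `c` is real; for `ε = -1` the signs are exchanged and so is that of `c`. -/
theorem theta_stdR (hE : IsRootVectors E) {ε : ℤˣ} (hθ : ∀ i, θ.toMap (simpleH b i : L) =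
    ((ε : ℤ) : ℂ) • (simpleH b i : L)) {c : ℂ} (hc : conj c = ((ε : ℤ) : ℂ) * c) (X : L) :
    θ.toMap (stdR b E c X) = stdR b E c (θ.toMap X) := by
  induction X using rootSpace_induction (H := H) with
  | h0 => simp
  | hadd x y hx hy => simp only [map_add, hx, hy]
  | h χ x hx =>
    have hx' := theta_mem_rootSpace hθ hx
    have hε : ∃ χ' : Weight ℂ H L, (χ' : H → ℂ) = ((ε : ℤ) : ℂ) • (χ : H → ℂ) := by
      rcases Int.units_eq_one_or ε with rfl | rfl
      · exact ⟨χ, by simp⟩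
      · exact ⟨-χ, by simp⟩
    by_cases h : χ.IsZero
    · obtain ⟨χ', hχ'⟩ := hε
      rw [← hχ'] at hx'
      have hz : χ'.IsZero := by
        change (χ' : H → ℂ) = 0
        rw [hχ', show (χ : H → ℂ) = 0 from h, smul_zero]
      rw [stdR_of_isZero b hE c h hx, stdR_of_isZero b hE c hz hx', map_zero]
    · have h0 : χ.IsNonZero := h
      set α : H.root := ⟨χ, by simpa using h0⟩ with hα
      rcases isPos_or_isPos_negRoot b α with hp | hp
      · rw [stdR_of_isPos b hE c hp hx, θ.toMap.map_smulₛₗ, hc]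
        rcases Int.units_eq_one_or ε with rfl | rfl
        · rw [stdR_of_isPos b hE c hp (x := θ.toMap x) (by simpa using hx')]; simp
        · rw [stdR_of_isPos_neg b hE c hp (x := θ.toMap x) (by
            rw [Weight.coe_neg]; simpa using hx')]
          simp
      · have hn : -(negRoot α).1 = χ := by rw [negRoot, neg_neg]
        have hn' : (-χ : Weight ℂ H L) = (negRoot α).1 := rfl
        rw [stdR_of_isPos_neg b hE c hp (by rw [hn]; exact hx), map_neg, θ.toMap.map_smulₛₗ, hc]
        rcases Int.units_eq_one_or ε with rfl | rfl
        · rw [stdR_of_isPos_neg b hE c hp (x := θ.toMap x) (by rw [hn]; simpa using hx')]; simp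
        · rw [stdR_of_isPos b hE c hp (x := θ.toMap x) (by
            rw [← hn', Weight.coe_neg]; simpa using hx')]
          simp

/-- Pairing with `E_{-α}` extracts the coefficient of `E_α`, and `θ` carries that component to the
one along `E_{α'}`. Checking this on root spaces makes the behaviour of the whole Killing form under
`θ` unnecessary. -/
theorem conj_killingForm_theta (hE : IsRootVectors E) {ε : ℤˣ}
    (hθ : ∀ i, θ.toMap (simpleH b i : L) = ((ε : ℤ) : ℂ) • (simpleH b i : L))
    {α α' : Weight ℂ H L} (hα : α.IsNonZero) (hα' : (α' : H → ℂ) = ((ε : ℤ) : ℂ) • (α : H → ℂ))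
    {a : ℂ} (ha : θ.toMap (E α) = a • E α') (Y : L) :
    conj (killingForm ℂ L (E (-α')) (θ.toMap Y)) = conj a * killingForm ℂ L (E (-α)) Y := by
  have hε : ((ε : ℤ) : ℂ) ≠ 0 := by simp
  have hα0' : α'.IsNonZero := fun h => hα (by
    have h' : (α' : H → ℂ) = 0 := h
    rw [hα'] at h'
    exact (smul_eq_zero_iff_right hε).mp h')
  induction Y using rootSpace_induction (H := H) with
  | h0 => simp
  | hadd x y hx hy => simp only [map_add, hx, hy]; ring
  | h χ x hx =>
    by_cases h : χ = α
    · subst h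
      obtain ⟨y, rfl⟩ := exists_eq_smul_rootVector hE hα hx
      rw [θ.toMap.map_smulₛₗ, ha, smul_smul, map_smul, map_smul (killingForm ℂ L (E (-χ))),
        killingForm_neg_self hE hα, killingForm_neg_self hE hα0']
      simp [mul_comm]
    · have hx' := theta_mem_rootSpace hθ hx
      rw [killingForm_of_ne hE (Weight.isNonZero_neg.mpr hα) (by rwa [neg_neg]) hx]
      have : killingForm ℂ L (E (-α')) (θ.toMap x) = 0 := by
        refine killingForm_apply_eq_zero_of_mem_rootSpace_of_add_ne_zero ℂ L H
          (hE.mem _ (Weight.isNonZero_neg.mpr hα0')) hx' ?_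
        rw [Weight.coe_neg, hα', neg_add_eq_sub, ← smul_sub]
        intro e
        exact h (DFunLike.coe_injective (sub_eq_zero.mp ((smul_eq_zero_iff_right hε).mp e)))
      rw [this]; simp

/-- Apply `θ` to `[h, E_i] = E_i`. The image `x` of `h` lies in the Cartan subalgebra and satisfies
`ε α_i(x) = 1` for all `i`, which determines it. -/
theorem theta_heightElt (hE : IsRootVectors E) {ε : ℤˣ}
    (hθ : ∀ i, θ.toMap (simpleH b i : L) = ((ε : ℤ) : ℂ) • (simpleH b i : L)) :
    θ.toMap (heightElt b : L) = ((ε : ℤ) : ℂ) • (heightElt b : L) := by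
  obtain ⟨x, hx⟩ : ∃ x : H, θ.toMap (heightElt b : L) = (x : L) := by
    refine ⟨∑ i, conj ((simpleHBasis b).repr (heightElt b) i) • ((ε : ℤ) : ℂ) • simpleH b i, ?_⟩
    conv_lhs => rw [← (simpleHBasis b).sum_repr (heightElt b)]
    simp only [simpleHBasis_apply, AddSubmonoidClass.coe_finsetSum, SetLike.val_smul, map_sum,
      θ.toMap.map_smulₛₗ, hθ]
  suffices h : x = ((ε : ℤ) : ℂ) • heightElt b by rw [hx, h]; rfl
  refine sub_eq_zero.mp (eq_zero_of_simple_eq_zero (b := b) fun i => ?_)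
  have hi := simple_isNonZero b i
  have h1 := lie_of_mem_rootSpace (theta_mem_rootSpace hθ (hE.mem _ hi)) x
  have h2 := congrArg θ.toMap (lie_of_mem_rootSpace (hE.mem _ hi) (heightElt b))
  rw [θ.map_lie, simple_heightElt, one_smul, hx, h1] at h2
  have hne : θ.toMap (E (simple b i)) ≠ 0 := fun h => by
    have h0 := θ.involutive (E (simple b i))
    rw [h, map_zero] at h0
    have := hE.norm _ hi
    simp [← h0] at this
  have h3 : ((ε : ℤ) : ℂ) * simple b i x = 1 := by
    refine smul_left_injective ℂ hne ?_
    simpa using h2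
  rw [← Weight.toLinear_apply, map_sub, map_smul, Weight.toLinear_apply, Weight.toLinear_apply,
    simple_heightElt, smul_eq_mul]
  linear_combination ((ε : ℤ) : ℂ) * h3 - simple b i x * Uq.units_sq ε

end RootData

/-! ### Matrix elements of the Gauss decomposition -/

section Gauss

variable {L : Type*} [LieRing L] [LieAlgebra ℂ L] {N : ℕ} {ρ : L →ₗ⁅ℂ⁆ Matrix (Fin N) (Fin N) ℂ}

theorem killingForm_lie_left (x y z : L) :
    killingForm ℂ L ⁅x, y⁆ z = -killingForm ℂ L y ⁅x, z⁆ := by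
  rw [← lie_skew, map_neg, LinearMap.neg_apply, traceForm_apply_lie_apply]

/-- By invariance, an element of degree `-1` pairs nontrivially only with degree `1`. -/
theorem killingForm_eq_zero_of_mem_gradedFiltration {h f u : L} (hf : ⁅h, f⁆ = -f)
    (hu : u ∈ gradedFiltration h 2) : killingForm ℂ L f u = 0 := by
  have hle : gradedFiltration h 2 ≤ LinearMap.ker (killingForm ℂ L f) :=
    gradedFiltration_le fun j x hj hx => by
      have h1 := killingForm_lie_left h f x
      rw [hf, hx, map_neg, LinearMap.neg_apply, map_smul, smul_eq_mul, neg_inj] at h1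
      have h2 : ((j - 1 : ℤ) : ℂ) * killingForm ℂ L f x = 0 := by
        push_cast
        linear_combination -h1
      rcases mul_eq_zero.mp h2 with h3 | h3
      · have : j - 1 = 0 := by exact_mod_cast h3
        lia
      · exact h3
  exact hle hu

/-- Matrix elements of a product of exponentials of elements of positive degree. -/
theorem exists_isAd_prod_gexp_killingForm {h e f : L} {l : List L}
    (hl : ∀ x ∈ l, x ∈ gradedFiltration h 1) (he : ⁅h, e⁆ = e) (hf : ⁅h, f⁆ = -f) :
    (∃ W, IsAd ρ (l.map (gexp ρ)).prod e W ∧ killingForm ℂ L f W = killingForm ℂ L f e) ∧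
      ∃ W, IsAd ρ (l.map (gexp ρ)).prod h W ∧ killingForm ℂ L f W = -killingForm ℂ L f l.sum := by
  have key := fun u hu => killingForm_eq_zero_of_mem_gradedFiltration (u := u) hf hu
  constructor
  · obtain ⟨W, h1, h2⟩ := exists_isAd_prod_gexp (ρ := ρ) hl
      (mem_gradedFiltration (h := h) (x := e) (j := 1) (by simpa using he) le_rfl)
    refine ⟨W, h1, sub_eq_zero.mp ?_⟩
    rw [← map_sub]
    exact key _ h2
  · obtain ⟨W, h1, h2⟩ := exists_isAd_prod_gexp_self (ρ := ρ) hl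
    refine ⟨W, h1, ?_⟩
    have h3 := key _ h2
    have h4 : killingForm ℂ L f h = 0 := by
      have := killingForm_lie_left h f h
      rw [hf, lie_self] at this
      simpa using this
    have h5 : killingForm ℂ L f ⁅l.sum, h⁆ = -killingForm ℂ L f l.sum := by
      have := killingForm_lie_left h f l.sum
      rw [hf, ← lie_skew, map_neg, map_neg, LinearMap.neg_apply] at this
      linear_combination -this
    rw [map_sub, map_add, h4, h5] at h3
    linear_combination h3

/-- Matrix elements of `Γ⁺ = M⁺ D`. -/
theorem killingForm_isAd_mul_gexp (hρ : Function.Injective ρ) {h e f Z : L} {a : ℂ} {l : List L}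
    (hl : ∀ x ∈ l, x ∈ gradedFiltration h 1) (he : ⁅h, e⁆ = e) (hf : ⁅h, f⁆ = -f)
    (hZh : ⁅Z, h⁆ = 0) (hZe : ⁅Z, e⁆ = a • e) (hfe : killingForm ℂ L f e = 1) {W : L} :
    (IsAd ρ ((l.map (gexp ρ)).prod * gexp ρ Z) e W → killingForm ℂ L f W = Complex.exp a) ∧
      (IsAd ρ ((l.map (gexp ρ)).prod * gexp ρ Z) h W →
        killingForm ℂ L f W = -killingForm ℂ L f l.sum) := by
  obtain ⟨⟨V, h1, h2⟩, ⟨V', h3, h4⟩⟩ :=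
    exists_isAd_prod_gexp_killingForm (ρ := ρ) hl he hf
  constructor
  · intro hW
    have := (isAd_gexp_of_lie_eq_smul (ρ := ρ) hZe).mul (h1.smul (Complex.exp a))
    rw [hW.unique hρ this, map_smul, h2, hfe, smul_eq_mul, mul_one]
  · intro hW
    have hD : IsAd ρ (gexp ρ Z) h h := by
      simpa using isAd_gexp_of_lie_eq_smul (ρ := ρ) (X := Z) (Y := h) (a := 0) (by simpa using hZh)
    rw [hW.unique hρ (hD.mul h3), h4]

/-- Matrix elements of `Γ⁻ = D⁻¹ M⁻`. -/
theorem killingForm_isAd_gexp_inv_mul (hρ : Function.Injective ρ) {h e f Z : L} {a : ℂ}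
    {l : List L} (hl : ∀ x ∈ l, x ∈ gradedFiltration h 1) (he : ⁅h, e⁆ = e) (hf : ⁅h, f⁆ = -f)
    (hZf : ⁅Z, f⁆ = a • f) (hfe : killingForm ℂ L f e = 1) {W : L} :
    (IsAd ρ ((gexp ρ Z)⁻¹ * (l.map (gexp ρ)).prod) e W → killingForm ℂ L f W = Complex.exp a) ∧
      (IsAd ρ ((gexp ρ Z)⁻¹ * (l.map (gexp ρ)).prod) h W →
        killingForm ℂ L f W = -(Complex.exp a * killingForm ℂ L f l.sum)) := by
  obtain ⟨⟨V, h1, h2⟩, ⟨V', h3, h4⟩⟩ :=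
    exists_isAd_prod_gexp_killingForm (ρ := ρ) hl he hf
  -- `D⁻¹` stands on the left, so it is moved onto `f` by invariance; the two minus signs cancel and
  -- the eigenvalue is `a`, not `-a`.
  have hT : ∀ V, killingForm ℂ L f ⁅-Z, V⁆ = a * killingForm ℂ L f V := fun V => by
    have := killingForm_lie_left Z f V
    rw [hZf, map_smul, LinearMap.smul_apply, smul_eq_mul] at this
    rw [this, neg_lie, map_neg]
  rw [← gexp_neg]
  constructor
  · intro hW
    obtain ⟨U, hU⟩ := exists_isAd_gexp (ρ := ρ) (-Z) V
    rw [hW.unique hρ (h1.mul hU), apply_isAd_gexp hρ hU _ hT, h2, hfe, mul_one]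
  · intro hW
    obtain ⟨U, hU⟩ := exists_isAd_gexp (ρ := ρ) (-Z) V'
    rw [hW.unique hρ (h3.mul hU), apply_isAd_gexp hρ hU _ hT, h4, mul_neg]

end Gauss

/-! ### Extraction of the charges from the moment map. -/

section Charges

variable {L : Type*} [LieRing L] [LieAlgebra ℂ L] [FiniteDimensional ℂ L] [IsKilling ℂ L]
  {H : LieSubalgebra ℂ L} [H.IsCartanSubalgebra] {b : (rootSystem H).Base} {N : ℕ}
  {ρ : L →ₗ⁅ℂ⁆ Matrix (Fin N) (Fin N) ℂ} {n : ℕ} {β : Fin n ≃ {α : H.root // b.IsPos α}}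
  {E : Weight ℂ H L → L}

theorem sum_killingForm_pos (hE : IsRootVectors E) (i : b.support) (x : Weight ℂ H L → ℂ) :
    killingForm ℂ L (E (-simple b i)) (∑ k, x (β k).1.1 • E (β k).1.1) = x (simple b i) := by
  have hi := simple_isNonZero b i
  set k₀ := β.symm ⟨i, RootPairing.Base.isPos_of_mem_support i.2⟩ with hk
  have hk₀ : (β k₀).1.1 = simple b i := by rw [hk, Equiv.apply_symm_apply]; rfl
  rw [map_sum, Finset.sum_eq_single k₀]
  · rw [hk₀, map_smul, killingForm_neg_self hE hi, smul_eq_mul, mul_one]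
  · intro k _ hne
    rw [map_smul, killingForm_of_ne hE (Weight.isNonZero_neg.mpr hi) _
      (hE.mem _ (LieSubalgebra.isNonZero_coe_root _)), smul_zero]
    rw [neg_neg, ← hk₀]
    exact fun e => hne (β.injective (Subtype.ext (Subtype.ext e)))
  · simp

theorem sum_killingForm_neg (hE : IsRootVectors E) (i : b.support) (x : Weight ℂ H L → ℂ) :
    killingForm ℂ L (E (simple b i)) (∑ k, x (-(β k).1.1) • E (-(β k).1.1)) =
      x (-simple b i) := by
  have hi := simple_isNonZero b i
  set k₀ := β.symm ⟨i, RootPairing.Base.isPos_of_mem_support i.2⟩ with hk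
  have hk₀ : (β k₀).1.1 = simple b i := by rw [hk, Equiv.apply_symm_apply]; rfl
  rw [map_sum, Finset.sum_eq_single k₀]
  · rw [hk₀, map_smul, hE.norm _ hi, smul_eq_mul, mul_one]
  · intro k _ hne
    rw [map_smul, killingForm_of_ne hE hi _
      (hE.mem _ (Weight.isNonZero_neg.mpr (LieSubalgebra.isNonZero_coe_root _))), smul_zero]
    rw [← hk₀]
    exact fun e => hne (β.injective (Subtype.ext (Subtype.ext (neg_injective e))))
  · simp

theorem lie_heightElt_rootVector (hE : IsRootVectors E) (α : H.root) :
    ⁅(heightElt b : L), E α.1⁆ = ((b.height α : ℤ) : ℂ) • E α.1 ∧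
      ⁅-(heightElt b : L), E (-α.1)⁆ = ((b.height α : ℤ) : ℂ) • E (-α.1) := by
  have hα := LieSubalgebra.isNonZero_coe_root α
  constructor
  · rw [lie_of_mem_rootSpace (hE.mem _ hα), root_heightElt]
  · rw [neg_lie, lie_of_mem_rootSpace (hE.mem _ (Weight.isNonZero_neg.mpr hα)), Weight.coe_neg,
      Pi.neg_apply, root_heightElt, neg_smul, neg_neg]

theorem lie_heightElt_simple (hE : IsRootVectors E) (i : b.support) :
    ⁅(heightElt b : L), E (simple b i)⁆ = E (simple b i) ∧
      ⁅-(heightElt b : L), E (-simple b i)⁆ = E (-simple b i) := by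
  have h := lie_heightElt_rootVector (b := b) hE (i : H.root)
  rw [RootPairing.Base.height_one_of_mem_support i.2, Int.cast_one] at h
  exact ⟨h.1.trans (one_smul _ _), h.2.trans (one_smul _ _)⟩

variable {θ : SemilinearInvolution L} {c : ℂ} {γ : ℝ} {A : Weight ℂ H L → ℂ} {M : Type*}
  {Γp Γm : M → GL (Fin N) ℂ} {QH : b.support → M → ℂ} {QE : Weight ℂ H L → M → ℂ}

theorem IsCharges.killingForm_plus (hE : IsRootVectors E) (hρ : Function.Injective ρ)
    (h : IsCharges b ρ E β θ c γ A Γp Γm QH QE) (x : M) (i : b.support) {W : L} :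
    (IsAd ρ (Γp x) (E (simple b i)) W → killingForm ℂ L (E (-simple b i)) W =
        Complex.exp (simple b i (cartanZ b c γ fun j => QH j x))) ∧
      (IsAd ρ (Γp x) (heightElt b : L) W → killingForm ℂ L (E (-simple b i)) W =
        -(Complex.I * c * γ * normConst c γ (dSym b i) * QE (simple b i) x)) := by
  have hi := simple_isNonZero b i
  let X : Fin n → L := fun k => (Complex.I * c * γ * A (β k).1.1 * QE (β k).1.1 x) • E (β k).1.1
  have hl : ∀ y ∈ List.ofFn X, y ∈ gradedFiltration (heightElt b : L) 1 := fun y hy => by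
    obtain ⟨k, rfl⟩ := (List.mem_ofFn' _ _).mp hy
    exact Submodule.smul_mem _ _ (mem_gradedFiltration (lie_heightElt_rootVector hE _).1 (β k).2)
  have hΓ : Γp x = ((List.ofFn X).map (gexp ρ)).prod *
      gexp ρ (cartanZ b c γ (fun i => QH i x) : L) := by
    rw [h.plus, unipPlus, List.map_ofFn]; rfl
  have hs : killingForm ℂ L (E (-simple b i)) (List.ofFn X).sum =
      Complex.I * c * γ * normConst c γ (dSym b i) * QE (simple b i) x := by
    rw [List.sum_ofFn, ← h.norm_pos]
    exact sum_killingForm_pos hE i fun α => Complex.I * c * γ * A α * QE α x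
  have h0 : ⁅((cartanZ b c γ (fun i => QH i x) : H) : L), (heightElt b : L)⁆ = 0 := by
    rw [← LieSubalgebra.coe_bracket, trivial_lie_zero]; rfl
  rw [hΓ, ← hs]
  exact killingForm_isAd_mul_gexp hρ hl (lie_heightElt_simple hE i).1
    (neg_eq_iff_eq_neg.mp (by rw [← neg_lie]; exact (lie_heightElt_simple hE i).2)) h0
    (lie_of_mem_rootSpace (hE.mem _ hi) _) (killingForm_neg_self hE hi)

/-- Mirror image of `IsCharges.killingForm_plus`, graded by `-h`. As `D⁻¹` stands to the left of
`M⁻`, the factor `e^{α_i(Z)}` also multiplies the charge, which is the source of the factors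
`q^{∓dQ^H}` in the non-split form. -/
theorem IsCharges.killingForm_minus (hE : IsRootVectors E) (hρ : Function.Injective ρ)
    (h : IsCharges b ρ E β θ c γ A Γp Γm QH QE) (x : M) (i : b.support) {W : L} :
    (IsAd ρ (Γm x) (E (-simple b i)) W → killingForm ℂ L (E (simple b i)) W =
        Complex.exp (simple b i (cartanZ b c γ fun j => QH j x))) ∧
      (IsAd ρ (Γm x) (-(heightElt b : L)) W → killingForm ℂ L (E (simple b i)) W =
        Complex.exp (simple b i (cartanZ b c γ fun j => QH j x)) *
          (Complex.I * c * γ * normConst c γ (dSym b i) * QE (-simple b i) x)) := by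
  have hi := simple_isNonZero b i
  let X : Fin n → L := fun k =>
    (-(Complex.I * c * γ * A (-(β k).1.1) * QE (-(β k).1.1) x)) • E (-(β k).1.1)
  have hl : ∀ y ∈ List.ofFn X, y ∈ gradedFiltration (-(heightElt b : L)) 1 := fun y hy => by
    obtain ⟨k, rfl⟩ := (List.mem_ofFn' _ _).mp hy
    exact Submodule.smul_mem _ _ (mem_gradedFiltration (lie_heightElt_rootVector hE _).2 (β k).2)
  have hΓ : Γm x = (gexp ρ (cartanZ b c γ (fun i => QH i x) : L))⁻¹ *
      ((List.ofFn X).map (gexp ρ)).prod := by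
    rw [h.minus, unipMinus, List.map_ofFn]; rfl
  have hs : killingForm ℂ L (E (simple b i)) (List.ofFn X).sum =
      -(Complex.I * c * γ * normConst c γ (dSym b i) * QE (-simple b i) x) := by
    rw [List.sum_ofFn, ← h.norm_neg]
    exact sum_killingForm_neg hE i fun α => -(Complex.I * c * γ * A α * QE α x)
  have key := killingForm_isAd_gexp_inv_mul (W := W) hρ hl (lie_heightElt_simple hE i).2
    (by rw [neg_lie, (lie_heightElt_simple hE i).1]) (lie_of_mem_rootSpace (hE.mem _ hi)
      (cartanZ b c γ (fun i => QH i x))) (hE.norm _ hi)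
  rw [hs, mul_neg, neg_neg] at key
  rw [hΓ]
  exact key

/-! ### Reality of the charges -/

/-- The conjugate of `a` is `a + 2πin`, so `Im a = -πn`, and the strict bound forces `n = 0`. -/
theorem conj_eq_self_of_conj_exp_eq {a : ℂ} (h : conj (Complex.exp a) = Complex.exp a)
    (ha : |a.im| < Real.pi) : conj a = a := by
  rw [← Complex.exp_conj, Complex.exp_eq_exp_iff_exists_int] at h
  obtain ⟨n, hn⟩ := h
  have him := congrArg Complex.im hn
  simp only [Complex.conj_im, Complex.add_im, Complex.mul_im, Complex.intCast_re,
    Complex.intCast_im, Complex.mul_re, Complex.re_ofNat, Complex.im_ofNat, Complex.ofReal_re,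
    Complex.ofReal_im, Complex.I_re, Complex.I_im] at him
  rw [abs_lt] at ha
  have hpi := Real.pi_pos
  have h1 : (n : ℝ) < 1 := by nlinarith
  have h2 : (-1 : ℝ) < n := by nlinarith
  have h3 : n = 0 := by
    have h1' : n < 1 := by exact_mod_cast h1
    have h2' : -1 < n := by exact_mod_cast h2
    lia
  rw [hn, h3]; simp

theorem exists_normConst_eq_ofReal {d : ℂ} {t : ℝ} (ht : 0 < t)
    (h : 4 * Complex.sinh (Complex.I * c * γ * d) / (Complex.I * c * γ) = t) :
    ∃ s : ℝ, s ≠ 0 ∧ normConst c γ d = s := by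
  refine ⟨t ^ (1 / 2 : ℝ), (Real.rpow_pos_of_pos ht _).ne', ?_⟩
  rw [normConst, h, Complex.ofReal_cpow ht.le]
  push_cast; rfl

/-- The radicand is `4 sin(γr)/γ`, positive exactly because `|γr| < π` gives the sine the sign of
`γ`. -/
theorem exists_normConst_one {r : ℝ} (hγ : γ ≠ 0) (hr : 0 < r) (h : |γ * r| < Real.pi) :
    ∃ s : ℝ, s ≠ 0 ∧ normConst 1 γ r = s := by
  refine exists_normConst_eq_ofReal (t := 4 * Real.sin (γ * r) / γ) ?_ ?_
  · rw [abs_lt] at h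
    rcases lt_or_gt_of_ne hγ with h0 | h0
    · have := Real.sin_neg_of_neg_of_neg_pi_lt (mul_neg_of_neg_of_pos h0 hr) h.1
      exact div_pos_of_neg_of_neg (by linarith) h0
    · have := Real.sin_pos_of_pos_of_lt_pi (mul_pos h0 hr) h.2
      positivity
  · have e : Complex.I * 1 * γ * r = ((γ * r : ℝ) : ℂ) * Complex.I := by push_cast; ring
    have hγ' : (γ : ℂ) ≠ 0 := by exact_mod_cast hγ
    rw [e, Complex.sinh_mul_I, ← Complex.ofReal_sin]
    push_cast
    field_simp

/-- The radicand is `4 sinh(γr)/γ`, which is positive for every `γ ≠ 0`. -/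
theorem exists_normConst_I {r : ℝ} (hγ : γ ≠ 0) (hr : 0 < r) :
    ∃ s : ℝ, s ≠ 0 ∧ normConst Complex.I γ r = s := by
  refine exists_normConst_eq_ofReal (t := 4 * Real.sinh (γ * r) / γ) ?_ ?_
  · rcases lt_or_gt_of_ne hγ with h0 | h0
    · have := Real.sinh_neg_iff.mpr (mul_neg_of_neg_of_pos h0 hr)
      exact div_pos_of_neg_of_neg (by linarith) h0
    · have := Real.sinh_pos_iff.mpr (mul_pos h0 hr)
      positivity
  · have e : Complex.I * Complex.I * γ * r = -((γ * r : ℝ) : ℂ) := by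
      rw [Complex.I_mul_I]; push_cast; ring
    have hγ' : (γ : ℂ) ≠ 0 := by exact_mod_cast hγ
    rw [e, Complex.sinh_neg, ← Complex.ofReal_sinh, Complex.I_mul_I]
    push_cast
    field_simp

theorem IsCharges.conj_split (hE : IsRootVectors E) (hρ : Function.Injective ρ) (hγ : γ ≠ 0)
    (hsmall : ∀ i, ‖(γ : ℂ) * dSym b i‖ < Real.pi)
    (hθ : ∀ i, θ.toMap (E (simple b i)) = E (simple b i) ∧
      θ.toMap (E (-simple b i)) = E (-simple b i))
    (h : IsCharges b ρ E β θ 1 γ A Γp Γm QH QE) (i : b.support) (x : M) :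
    conj (QH i x) = -QH i x ∧ conj (QE (simple b i) x) = -QE (simple b i) x ∧
      conj (QE (-simple b i) x) = -QE (-simple b i) x := by
  have hi := simple_isNonZero b i
  have hH : ∀ i, θ.toMap (simpleH b i : L) = (((1 : ℤˣ) : ℤ) : ℂ) • (simpleH b i : L) := fun i => by
    rw [← lie_simple_rootVectors b hE, θ.map_lie, (hθ i).1, (hθ i).2]; simp
  have hh := theta_heightElt hE hH
  have htw := (isTwisted_of_mem_dualGroup hρ (theta_stdR hE hH (c := 1) (by simp))
    (h.mem_dualGroup x)).1 (by simp)
  have hp := conj_killingForm_theta hE hH hi (α' := simple b i) (by simp) (a := 1)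
    (by rw [one_smul]; exact (hθ i).1)
  have hm := conj_killingForm_theta hE hH (Weight.isNonZero_neg.mpr hi) (α' := -simple b i)
    (by simp) (a := 1) (by rw [one_smul]; exact (hθ i).2)
  simp only [map_one, one_mul, neg_neg, Units.val_one, Int.cast_one, one_smul] at hp hm hh
  set a := simple b i (cartanZ b 1 γ fun j => QH j x) with ha
  obtain ⟨r, hr, hd⟩ := exists_dSym_eq_ofReal b i
  obtain ⟨s, hs, hs'⟩ := exists_normConst_one hγ hr (by
    have := hsmall i
    rwa [hd, ← Complex.ofReal_mul, Complex.norm_real, Real.norm_eq_abs] at this)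
  have hexp : conj (Complex.exp a) = Complex.exp a := by
    obtain ⟨W, h1, h2⟩ := htw.1 (E (simple b i))
    rw [(hθ i).1] at h2
    have := hp W
    rwa [((h.killingForm_plus hE hρ x i).1 h1), ((h.killingForm_plus hE hρ x i).1 h2)] at this
  have ha' := conj_eq_self_of_conj_exp_eq hexp (h.branch x i)
  have hγ' : (γ : ℂ) ≠ 0 := by exact_mod_cast hγ
  have hr' : (r : ℂ) ≠ 0 := by exact_mod_cast hr.ne'
  have hs0 : (s : ℂ) ≠ 0 := by exact_mod_cast hs
  refine ⟨?_, ?_, ?_⟩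
  · rw [ha, simple_cartanZ, hd] at ha'
    simp only [map_mul, Complex.conj_I, map_one, Complex.conj_ofReal] at ha'
    have hne : Complex.I * 1 * γ * r ≠ 0 := by simp [hγ', hr']
    refine mul_left_cancel₀ hne ?_
    linear_combination -ha'
  · obtain ⟨W, h1, h2⟩ := htw.1 (heightElt b : L)
    rw [hh] at h2
    have := hp W
    rw [((h.killingForm_plus hE hρ x i).2 h1), ((h.killingForm_plus hE hρ x i).2 h2), hd, hs'] at this
    simp only [map_mul, map_neg, Complex.conj_I, map_one, Complex.conj_ofReal] at this
    have hne : Complex.I * 1 * γ * s ≠ 0 := by simp [hγ', hs0]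
    refine mul_left_cancel₀ hne ?_
    linear_combination this
  · obtain ⟨W, h1, h2⟩ := htw.2 (-(heightElt b : L))
    rw [map_neg, hh] at h2
    have := hm W
    rw [((h.killingForm_minus hE hρ x i).2 h1), ((h.killingForm_minus hE hρ x i).2 h2), hd, hs',
      map_mul, hexp] at this
    -- The factor from `D⁻¹` is real by `hexp` and drops out.
    have := mul_left_cancel₀ (Complex.exp_ne_zero _) this
    simp only [map_mul, Complex.conj_I, map_one, Complex.conj_ofReal] at this
    have hne : Complex.I * 1 * γ * s ≠ 0 := by simp [hγ', hs0]
    refine mul_left_cancel₀ hne ?_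
    linear_combination -this

theorem IsCharges.conj_nonSplit (hE : IsRootVectors E) (hρ : Function.Injective ρ) (hγ : γ ≠ 0)
    {lam : b.support → ℤˣ}
    (hθ : ∀ i, θ.toMap (E (simple b i)) = -(((lam i : ℤ) : ℂ) • E (-simple b i)) ∧
      θ.toMap (E (-simple b i)) = -(((lam i : ℤ) : ℂ) • E (simple b i)))
    (h : IsCharges b ρ E β θ Complex.I γ A Γp Γm QH QE) (i : b.support) (x : M) :
    conj (QH i x) = QH i x ∧
      conj (QE (simple b i) x) =
        ((lam i : ℤ) : ℂ) * qPow Complex.I γ (-(dSym b i * QH i x)) * QE (-simple b i) x ∧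
      conj (QE (-simple b i) x) =
        ((lam i : ℤ) : ℂ) * qPow Complex.I γ (dSym b i * QH i x) * QE (simple b i) x := by
  have hi := simple_isNonZero b i
  have hH : ∀ i, θ.toMap (simpleH b i : L) = (((-1 : ℤˣ) : ℤ) : ℂ) • (simpleH b i : L) :=
    fun i => by
      rw [← lie_simple_rootVectors b hE, θ.map_lie, (hθ i).1, (hθ i).2, neg_lie, lie_neg, neg_neg,
        smul_lie, lie_smul, smul_smul, Uq.units_sq, one_smul, ← lie_skew]
      simp
  have hh := theta_heightElt hE hH
  have htw := (isTwisted_of_mem_dualGroup hρ (theta_stdR hE hH (c := Complex.I) (by simp))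
    (h.mem_dualGroup x)).2 (by simp)
  have hp := conj_killingForm_theta hE hH hi (α' := -simple b i) (by simp)
    (a := -((lam i : ℤ) : ℂ)) (by rw [neg_smul]; exact (hθ i).1)
  simp only [map_neg, map_intCast, neg_neg, Units.val_neg, Units.val_one, Int.cast_neg,
    Int.cast_one, neg_smul, one_smul] at hp hh
  set a := simple b i (cartanZ b Complex.I γ fun j => QH j x) with ha
  obtain ⟨r, hr, hd⟩ := exists_dSym_eq_ofReal b i
  obtain ⟨s, hs, hs'⟩ := exists_normConst_I hγ hr
  have hlam := Uq.units_sq (lam i)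
  have hexp : conj (Complex.exp a) = Complex.exp a := by
    obtain ⟨W, h1, h2⟩ := htw (E (simple b i))
    -- Scaling by `-λ_i` turns `θ E_{α_i} = -λ_i E_{-α_i}` into `E_{-α_i}`, since `λ_i² = 1`.
    have h3 := h2.smul (-((lam i : ℤ) : ℂ))
    rw [(hθ i).1, smul_neg, neg_smul, neg_neg, smul_smul, hlam, one_smul] at h3
    have h4 := (h.killingForm_minus hE hρ x i).1 h3
    have h5 := hp W
    rw [(h.killingForm_plus hE hρ x i).1 h1] at h5
    rw [map_smul, smul_eq_mul] at h4
    have h6 := congrArg conj h4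
    rw [map_mul, h5] at h6
    simp only [map_neg, map_intCast] at h6
    linear_combination -h6 + Complex.exp a * hlam
  have ha' := conj_eq_self_of_conj_exp_eq hexp (h.branch x i)
  have hγ' : (γ : ℂ) ≠ 0 := by exact_mod_cast hγ
  have hr' : (r : ℂ) ≠ 0 := by exact_mod_cast hr.ne'
  have hs0 : (s : ℂ) ≠ 0 := by exact_mod_cast hs
  have hQ : conj (QH i x) = QH i x := by
    rw [ha, simple_cartanZ, hd] at ha'
    simp only [map_mul, Complex.conj_I, Complex.conj_ofReal] at ha'
    have hne : Complex.I * Complex.I * γ * r ≠ 0 := by simp [hγ', hr']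
    refine mul_left_cancel₀ hne ?_
    linear_combination ha'
  have hq : Complex.exp a = qPow Complex.I γ (-(dSym b i * QH i x)) := by
    rw [ha, simple_cartanZ, qPow]; congr 1; ring
  -- Compare the images of `h` under `Ad Γ⁺` and of `θ h = -h` under `Ad Γ⁻`. Both formulas for the
  -- conjugates follow from this identity, one of them by conjugating it.
  have hE1 : conj (QE (-simple b i) x) * Complex.exp a =
      ((lam i : ℤ) : ℂ) * QE (simple b i) x := by
    obtain ⟨W, h1, h2⟩ := htw (heightElt b : L)
    rw [hh] at h2
    have h3 := hp W
    rw [((h.killingForm_plus hE hρ x i).2 h1), ((h.killingForm_minus hE hρ x i).2 h2), hd, hs',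
      map_mul, hexp] at h3
    simp only [map_mul, Complex.conj_I, Complex.conj_ofReal] at h3
    have hne : Complex.I * Complex.I * γ * s ≠ 0 := by simp [hγ', hs0]
    refine mul_left_cancel₀ hne ?_
    linear_combination h3
  refine ⟨hQ, ?_, ?_⟩
  · have h4 := congrArg conj hE1
    rw [map_mul, map_mul, Complex.conj_conj, hexp, map_intCast] at h4
    rw [← hq]
    linear_combination (-((lam i : ℤ) : ℂ)) * h4 - conj (QE (simple b i) x) * hlam
  · have h4 := Uq.qPow_mul_qPow_neg Complex.I γ (dSym b i * QH i x)
    rw [← hq] at h4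
    linear_combination qPow Complex.I γ (dSym b i * QH i x) * hE1 -
      conj (QE (-simple b i) x) * h4

theorem norm_qPow_one (γ : ℝ) : ‖qPow 1 γ 1‖ = 1 := by
  rw [qPow, Complex.norm_exp]; simp

theorem qPow_I_one (γ : ℝ) : qPow Complex.I γ 1 = (Real.exp γ : ℂ) := by
  rw [qPow, neg_mul, Complex.I_mul_I]; simp

end Charges

end QReality

end

/-! ### The theorem, assembled from the two cases. -/

open QReality in
theorem mainTheorem6 {L : Type*} [LieRing L] [LieAlgebra ℂ L] [FiniteDimensional ℂ L]
    [LieAlgebra.IsSemisimple ℂ L]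
    -- Cartan subalgebra, simple roots, root vectors
    (H : LieSubalgebra ℂ L) [H.IsCartanSubalgebra]
    (b : (LieAlgebra.IsKilling.rootSystem H).Base)
    (E : LieModule.Weight ℂ H L → L) (hE : IsRootVectors E)
    -- the complex group, as a linear group with Lie algebra `ρ(L)`
    {N : ℕ} (ρ : L →ₗ⁅ℂ⁆ Matrix (Fin N) (Fin N) ℂ) (hρ : Function.Injective ρ)
    -- labelling of the positive roots
    {n : ℕ} (β : Fin n ≃ {α : H.root // b.IsPos α})
    -- the real form and the deformation parameter
    (θ : SemilinearInvolution L) (γ : ℝ) (hγ : γ ≠ 0)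
    -- the moment map and its charges, functions on the phase space `M`
    {M : Type*} (Γp Γm : M → GL (Fin N) ℂ) (A : LieModule.Weight ℂ H L → ℂ)
    (QH : b.support → M → ℂ) (QE : LieModule.Weight ℂ H L → M → ℂ) :
    -- split case, `c = 1`
    ((∀ i, ‖(γ : ℂ) * dSym b i‖ < Real.pi) →
      ‖qPow 1 γ 1‖ = 1 ∧
      (∃! τ : Uq (uqParam b 1 γ) →+* Uq (uqParam b 1 γ), Uq.IsSplitForm τ) ∧
      ((∀ i, θ.toMap (E (simple b i)) = E (simple b i) ∧
          θ.toMap (E (-simple b i)) = E (-simple b i)) →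
        IsCharges b ρ E β θ 1 γ A Γp Γm QH QE →
        (∀ i x, conj (QH i x) = -QH i x) ∧
        (∀ i x, conj (QE (simple b i) x) = -QE (simple b i) x) ∧
        (∀ i x, conj (QE (-simple b i) x) = -QE (-simple b i) x) ∧
        (∀ (τ : Uq (uqParam b 1 γ) →+* Uq (uqParam b 1 γ)) (br : (M → ℂ) → (M → ℂ) → M → ℂ)
          (φ : Uq (uqParam b 1 γ) →ₐ[ℂ] (M → ℂ)), Uq.IsSplitForm τ →
          Uq.IsEvaluation QH (fun i => QE (simple b i)) (fun i => QE (-simple b i)) br φ →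
          ∀ a x, φ (τ a) x = conj (φ a x)))) ∧
    -- non-split case, `c = i`
    (∀ lam : b.support → ℤˣ,
      qPow Complex.I γ 1 = (Real.exp γ : ℂ) ∧
      (∃! τ : Uq (uqParam b Complex.I γ) →+* Uq (uqParam b Complex.I γ),
        Uq.IsNonSplitForm lam τ) ∧
      ((∀ i, θ.toMap (E (simple b i)) = -(((lam i : ℤ) : ℂ) • E (-simple b i)) ∧
          θ.toMap (E (-simple b i)) = -(((lam i : ℤ) : ℂ) • E (simple b i))) →
        IsCharges b ρ E β θ Complex.I γ A Γp Γm QH QE →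
        (∀ i x, conj (QH i x) = QH i x) ∧
        (∀ i x, conj (QE (simple b i) x) =
          ((lam i : ℤ) : ℂ) * qPow Complex.I γ (-(dSym b i * QH i x)) * QE (-simple b i) x) ∧
        (∀ i x, conj (QE (-simple b i) x) =
          ((lam i : ℤ) : ℂ) * qPow Complex.I γ (dSym b i * QH i x) * QE (simple b i) x) ∧
        (∀ (τ : Uq (uqParam b Complex.I γ) →+* Uq (uqParam b Complex.I γ))
          (br : (M → ℂ) → (M → ℂ) → M → ℂ) (φ : Uq (uqParam b Complex.I γ) →ₐ[ℂ] (M → ℂ)),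
          Uq.IsNonSplitForm lam τ →
          Uq.IsEvaluation QH (fun i => QE (simple b i)) (fun i => QE (-simple b i)) br φ →
          ∀ a x, φ (τ a) x = conj (φ a x)))) := by
  refine ⟨fun hsmall => ⟨norm_qPow_one γ, Uq.existsUnique_isSplitForm rfl (conj_dSym b),
    fun hθ h => ?_⟩, fun lam => ⟨qPow_I_one γ,
    Uq.existsUnique_isNonSplitForm rfl (isSymmetrized_uqParam b _ γ) lam, fun hθ h => ?_⟩⟩
  · have key := h.conj_split hE hρ hγ hsmall hθ
    exact ⟨fun i x => (key i x).1, fun i x => (key i x).2.1, fun i x => (key i x).2.2,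
      fun τ br φ hτ hφ a x => hτ.map_conj rfl (conj_dSym b) hφ (fun i x => (key i x).1)
        (fun i x => (key i x).2.1) (fun i x => (key i x).2.2) a x⟩
  · have key := h.conj_nonSplit hE hρ hγ hθ
    exact ⟨fun i x => (key i x).1, fun i x => (key i x).2.1, fun i x => (key i x).2.2,
      fun τ br φ hτ hφ a x => hτ.map_conj rfl (conj_dSym b) hφ (fun i x => (key i x).1)
        (fun i x => (key i x).2.1) (fun i x => (key i x).2.2) a x⟩
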